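/- Let $n\ge 0$ be an integer, $1\le p,q\le\infty$ and $s>1$. Let $\mathcal S_s(\mathbb R^n)$ be the Gelfand–Shilov space of all $\varphi\in C^\infty(\mathbb R^n)$ for which there are $h,C>0$ with $\sup_x|x^\alpha\partial^\beta \varphi(x)|\le C h^{|\alpha|+|\beta|}(\alpha!\,\beta!)^s$ for all multi-indices $\alpha,\beta$, and let $\mathcal S_s'(\mathbb R^n)$ be its dual (linear functionals on $\mathcal S_s$ that are bounded, for each fixed $h$, with respect to the least such $C$). Let $\mathcal F\varphi(\xi)=(2\pi)^{-n/2}\int \varphi(x)e^{-ix\cdot\xi}\,dx$, extended to $\mathcal S_s'$ by duality. Fix $\rho\in\mathcal S_s(\mathbb R^n)$ with values in $[0,1]$, with $\operatorname{supp}\rho\subset[-1,1]^n$, $\rho(\xi)=1$ for $|\xi|\le\frac12$, and $\sum_{j\in\mathbb Z^n}\rho(\xi-j)>0$ for every $\xi\in\mathbb R^n$. Put $\sigma_k(\xi)=\rho(\xi-k)\big/\sum_{j\in\mathbb Z^n}\rho(\xi-j)$ and $\Box_k f=\mathcal F^{-1}(\sigma_k\mathcal Ff)$ for $k\in\mathbb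 Z^n$, and for $f\in\mathcal S_s'(\mathbb R^n)$ $$\|f\|_{\mathcal{GM}^{p,q}_s}=\Big(\sum_{k\in\mathbb Z^n}e^{q|k|^{1/s}}\|\Box_kf\|_{L^p}^q\Big)^{1/q}$$ (a supremum if $q=\infty$; $\|\Box_k f\|_{L^p}=\infty$ if $\Box_kf$ is not given by a function in $L^p$). Let $\mathcal{GM}^{p,q}_s=\{f\in\mathcal S_s'(\mathbb R^n):\|f\|_{\mathcal{GM}^{p,q}_s}<\infty\}$. There is a constant $C>0$, depending only on $\rho,n,s,p,q$, such that for all $f,g\in\mathcal{GM}^{2p,q}_s$ the product $fg$ is well defined (that is, $f$ and $g$ are given by essentially bounded functions, and $fg\in\mathcal S_s'$ is the distribution given by their pointwise product, which does not depend on the choice of these functions), $fg\in\mathcal{GM}^{p,q}_s$, and $$\|fg\|_{\mathcal{GM}^{p,q}_s}\le C\,\|f\|_{\mathcal{GM}^{2p,q}_s}\|g\|_{\mathcal{GM}^{2p,q}_s}.$$ In particular $\mathcal{GM}^{p,q}_s$ is an algebra under multiplication: it is a linear subspace of $\mathcal S_s'$, and there is a constant $C'>0$, depending only on $\rho,n,s,p,q$,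 such that for all $f,g\in\mathcal{GM}^{p,q}_s$ the product $fg$ is well defined in the same sense, lies in $\mathcal{GM}^{p,q}_s$, and satisfies $\|fg\|_{\mathcal{GM}^{p,q}_s}\le C'\|f\|_{\mathcal{GM}^{p,q}_s}\|g\|_{\mathcal{GM}^{p,q}_s}$. -/

import Mathlib

open scoped ENNReal NNReal ContDiff FourierTransform SchwartzMap
open MeasureTheory

namespace GevreyModulation

/-- The Gelfand-Shilov estimate `|x| ^ k * |D ^ m f (x)| ≤ A * h ^ (k + m) * (k! * m!) ^ s`, i.e.
`‖f‖_{s,h} ≤ A`. The conditions are stated, as for Mathlib's Schwartz space, with powers of the norm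
and full Fréchet derivatives in place of the monomials `x ^ α` and the partial derivatives `∂ ^ β`.
Since `α! ≤ |α|! ≤ n ^ |α| * α!`, this only changes `h` by a factor depending on `n` and `s`, so it
gives the same space `S_s = ⋃ h, S_{s,h}` and the same dual `⋂ h, (S_{s,h})'`. -/
def GSBound {V F : Type*} [NormedAddCommGroup V] [NormedSpace ℝ V]
    [NormedAddCommGroup F] [NormedSpace ℝ F] (s h A : ℝ) (f : V → F) : Prop :=
  ∀ (k m : ℕ) (x : V), ‖x‖ ^ k * ‖iteratedFDeriv ℝ m f x‖ ≤
    A * h ^ (k + m) * ((k.factorial : ℝ) * m.factorial) ^ s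

theorem factorial_rpow_le {s : ℝ} (hs : 0 ≤ s) (a b : ℕ) :
    (a.factorial : ℝ) ^ s * (b.factorial : ℝ) ^ s ≤ ((a + b).factorial : ℝ) ^ s := by
  rw [← Real.mul_rpow (by positivity) (by positivity)]
  gcongr
  exact_mod_cast Nat.le_of_dvd (Nat.factorial_pos _) (Nat.factorial_mul_factorial_dvd_factorial_add a b)

theorem choose_mul_factorial_rpow_le {s : ℝ} (hs : 1 ≤ s) (a b : ℕ) :
    ((a + b).choose a : ℝ) * ((a.factorial : ℝ) ^ s * (b.factorial : ℝ) ^ s) ≤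
      ((a + b).factorial : ℝ) ^ s := by
  have h0 : ((a + b).choose a : ℝ) * ((a.factorial : ℝ) * b.factorial) = (a + b).factorial := by
    rw [← Nat.add_choose_mul_factorial_mul_factorial a b]
    push_cast
    rw [Nat.choose_symm_add]
    ring
  have h1 : ((a.factorial : ℝ) * b.factorial) ^ (s - 1) ≤ ((a + b).factorial : ℝ) ^ (s - 1) := by
    have := factorial_rpow_le (s := s - 1) (by linarith) a b
    rwa [← Real.mul_rpow (by positivity) (by positivity)] at this
  have e (x : ℝ) (hx : 0 < x) : x ^ s = x * x ^ (s - 1) := by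
    rw [Real.rpow_sub hx, Real.rpow_one]
    field_simp
  rw [← Real.mul_rpow (by positivity) (by positivity), e _ (by positivity), ← mul_assoc, h0,
    e ((a + b).factorial : ℝ) (by positivity)]
  gcongr

theorem leibniz_sum_le {s A B H : ℝ} (hs : 0 ≤ s) (hA : 0 ≤ A) (hB : 0 ≤ B) (hH : 0 ≤ H)
    (F G : ℕ → ℝ) (hF : ∀ j, F j ≤ B * H ^ j * (j.factorial : ℝ) ^ s) (hG0 : ∀ j, 0 ≤ G j)
    (hG : ∀ j, G j ≤ A * H ^ j * (j.factorial : ℝ) ^ s) (m : ℕ) :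
    ∑ j ∈ Finset.range (m + 1), (m.choose j : ℝ) * F j * G (m - j) ≤
      A * B * (2 * H) ^ m * (m.factorial : ℝ) ^ s := by
  calc ∑ j ∈ Finset.range (m + 1), (m.choose j : ℝ) * F j * G (m - j)
      ≤ ∑ j ∈ Finset.range (m + 1), (m.choose j : ℝ) * (A * B * H ^ m * (m.factorial : ℝ) ^ s) := by
        refine Finset.sum_le_sum fun j hj => ?_
        have hj' : j + (m - j) = m := by
          have := Finset.mem_range.mp hj
          omega
        rw [mul_assoc]
        refine mul_le_mul_of_nonneg_left ?_ (by positivity)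
        calc F j * G (m - j) ≤ (B * H ^ j * (j.factorial : ℝ) ^ s) *
              (A * H ^ (m - j) * ((m - j).factorial : ℝ) ^ s) :=
              mul_le_mul (hF j) (hG _) (hG0 _) (by positivity)
          _ = A * B * H ^ (j + (m - j)) *
              ((j.factorial : ℝ) ^ s * ((m - j).factorial : ℝ) ^ s) := by rw [pow_add]; ring
          _ ≤ A * B * H ^ (j + (m - j)) * (((j + (m - j)).factorial : ℝ) ^ s) := by
              gcongr
              exact factorial_rpow_le hs _ _
          _ = _ := by rw [hj']
    _ = _ := by
        rw [← Finset.sum_mul, ← Nat.cast_sum, Nat.sum_range_choose, mul_pow]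
        push_cast
        ring

section Bounds

variable {V F : Type*} [NormedAddCommGroup V] [NormedSpace ℝ V]
  [NormedAddCommGroup F] [NormedSpace ℝ F]

theorem GSBound.nonneg {s h A : ℝ} {f : V → F} (hf : GSBound s h A f) : 0 ≤ A := by
  have := (mul_nonneg (by positivity) (norm_nonneg _)).trans (hf 0 0 0)
  simpa using this

theorem GSBound.mono {s h A h' A' : ℝ} {f : V → F} (hf : GSBound s h A f) (hh : 0 ≤ h)
    (hh' : h ≤ h') (hA : A ≤ A') : GSBound s h' A' f := by
  intro k m x
  have := hf.nonneg
  have := hf.nonneg.trans hA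
  refine (hf k m x).trans ?_
  gcongr

theorem GSBound.deriv_le {s h A : ℝ} {f : V → F} (hf : GSBound s h A f) (m : ℕ) (x : V) :
    ‖iteratedFDeriv ℝ m f x‖ ≤ A * h ^ m * (m.factorial : ℝ) ^ s := by
  simpa using hf 0 m x

theorem GSBound.smul_left {s h A B H : ℝ} {f : V → F} (hs : 0 ≤ s) (hf : GSBound s h A f)
    (hh : 0 ≤ h) (hh1 : 1 ≤ H) (hhH : h ≤ H) {𝕜 : Type*} [RCLike 𝕜] [NormedSpace 𝕜 F]
    [IsScalarTower ℝ 𝕜 F]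
    (hfc : ContDiff ℝ ∞ f) {g : V → 𝕜} (hg : ContDiff ℝ ∞ g)
    (hB : 0 ≤ B) (hgB : ∀ m x, ‖iteratedFDeriv ℝ m g x‖ ≤ B * H ^ m * (m.factorial : ℝ) ^ s) :
    GSBound s (2 * H) (B * A) (fun x => g x • f x) := by
  intro k m x
  have hA := hf.nonneg
  have h1 := norm_iteratedFDeriv_smul_le hg hfc x (n := m) (mod_cast le_top)
  have h2 := leibniz_sum_le hs (A := A * H ^ k * (k.factorial : ℝ) ^ s) (by positivity) hB
    (by positivity) (fun j => ‖iteratedFDeriv ℝ j g x‖)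
    (fun j => ‖x‖ ^ k * ‖iteratedFDeriv ℝ j f x‖) (fun j => hgB j x) (fun j => by positivity)
    (fun j => by
      have := (hf.mono hh hhH le_rfl) k j x
      rw [Real.mul_rpow (by positivity) (by positivity), pow_add] at this
      refine this.trans (le_of_eq (by ring))) m
  calc ‖x‖ ^ k * ‖iteratedFDeriv ℝ m (fun x => g x • f x) x‖
      ≤ ‖x‖ ^ k * ∑ i ∈ Finset.range (m + 1),
        (m.choose i : ℝ) * ‖iteratedFDeriv ℝ i g x‖ * ‖iteratedFDeriv ℝ (m - i) f x‖ := by gcongr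
    _ = ∑ j ∈ Finset.range (m + 1), (m.choose j : ℝ) * ‖iteratedFDeriv ℝ j g x‖ *
        (‖x‖ ^ k * ‖iteratedFDeriv ℝ (m - j) f x‖) := by
        rw [Finset.mul_sum]
        exact Finset.sum_congr rfl fun j _ => by ring
    _ ≤ _ := h2
    _ ≤ B * A * (2 * H) ^ (k + m) * ((k.factorial : ℝ) * m.factorial) ^ s := by
        rw [Real.mul_rpow (by positivity) (by positivity), pow_add]
        have : H ^ k ≤ (2 * H) ^ k := by gcongr; linarith
        calc _ = (B * A * (2 * H) ^ m * ((k.factorial : ℝ) ^ s * (m.factorial : ℝ) ^ s)) * H ^ k := by ring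
          _ ≤ (B * A * (2 * H) ^ m * ((k.factorial : ℝ) ^ s * (m.factorial : ℝ) ^ s)) * (2 * H) ^ k := by gcongr
          _ = _ := by ring

/-- Gevrey bounds are stable under taking reciprocals of functions bounded below. -/
theorem inv_deriv_le {s B H c : ℝ} (hs : 1 ≤ s) (hc : 0 < c) (hH : 0 < H) (hB : 0 ≤ B)
    {g : V → ℝ} (hg : ContDiff ℝ ∞ g) (hgc : ∀ x, c ≤ g x)
    (hgB : ∀ m x, ‖iteratedFDeriv ℝ m g x‖ ≤ B * H ^ m * (m.factorial : ℝ) ^ s) (m : ℕ) (x : V) :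
    ‖iteratedFDeriv ℝ m (fun y => (g y)⁻¹) x‖ ≤
      c⁻¹ * (2 * H * (1 + B / c)) ^ m * (m.factorial : ℝ) ^ s := by
  set L := 2 * H * (1 + B / c) with hL
  have hLpos : 0 < L := by positivity
  have hgi : ContDiff ℝ ∞ (fun y => (g y)⁻¹) := hg.inv fun y => (hc.trans_le (hgc y)).ne'
  induction m using Nat.strong_induction_on with
  | _ m ih =>
    rcases Nat.eq_zero_or_pos m with rfl | hm
    · simp only [norm_iteratedFDeriv_zero, norm_inv, pow_zero, Nat.factorial_zero, Nat.cast_one,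
        Real.one_rpow, mul_one]
      have := hgc x
      rw [Real.norm_of_nonneg (hc.le.trans this)]
      gcongr
    · -- D^m (g · (1/g)) = 0; freeze `g` at `x`
      have hsplit : (fun y => (g x) • (g y)⁻¹) = fun y => 1 - (g y - g x) * (g y)⁻¹ := by
        funext y
        have : g y ≠ 0 := (hc.trans_le (hgc y)).ne'
        simp only [smul_eq_mul]
        field_simp
        ring
      have hprod : ContDiff ℝ ∞ (fun y => (g y - g x) * (g y)⁻¹) := (hg.sub contDiff_const).mul hgi
      have h1 : g x * ‖iteratedFDeriv ℝ m (fun y => (g y)⁻¹) x‖ =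
          ‖iteratedFDeriv ℝ m (fun y => (g y - g x) * (g y)⁻¹) x‖ := by
        have e1 : iteratedFDeriv ℝ m (fun y => (g x) • (g y)⁻¹) x =
            (g x) • iteratedFDeriv ℝ m (fun y => (g y)⁻¹) x :=
          iteratedFDeriv_const_smul_apply' ((hgi.of_le (mod_cast le_top)).contDiffAt)
        have e2 : iteratedFDeriv ℝ m (fun y => 1 - (g y - g x) * (g y)⁻¹) x =
            - iteratedFDeriv ℝ m (fun y => (g y - g x) * (g y)⁻¹) x := by
          rw [fun_iteratedFDeriv_sub_apply contDiffAt_const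
            ((hprod.of_le (mod_cast le_top)).contDiffAt), iteratedFDeriv_const_of_ne hm.ne']
          simp
        rw [hsplit, e2] at e1
        have := congrArg norm e1
        rw [norm_neg, norm_smul, Real.norm_of_nonneg (hc.le.trans (hgc x))] at this
        exact this.symm
      have h2 := norm_iteratedFDeriv_mul_le (hg.sub (contDiff_const (c := g x))) hgi x (n := m)
        (mod_cast le_top)
      have h3 : ∀ j ∈ Finset.range m, ((m.choose (j + 1) : ℝ)) *
          ‖iteratedFDeriv ℝ (j + 1) (fun y => g y - g x) x‖ *
          ‖iteratedFDeriv ℝ (m - (j + 1)) (fun y => (g y)⁻¹) x‖ ≤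
          B * c⁻¹ * (L ^ m * (H / L * (1 / 2) ^ j)) * (m.factorial : ℝ) ^ s := by
        intro j hj
        have hjm : j + 1 + (m - (j + 1)) = m := by
          have := Finset.mem_range.mp hj
          omega
        have e : iteratedFDeriv ℝ (j + 1) (fun y => g y - g x) x = iteratedFDeriv ℝ (j + 1) g x := by
          rw [fun_iteratedFDeriv_sub_apply ((hg.of_le (mod_cast le_top)).contDiffAt) contDiffAt_const,
            iteratedFDeriv_const_of_ne (Nat.succ_ne_zero j)]
          simp
        have hpow : H ^ (j + 1) * L ^ (m - (j + 1)) ≤ L ^ m * (H / L * (1 / 2) ^ j) := by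
          have e3 : H ^ (j + 1) * L ^ (m - (j + 1)) = L ^ m * (H / L * (H / L) ^ j) := by
            rw [← pow_succ', div_pow]
            nth_rewrite 2 [← hjm]
            rw [pow_add]
            field_simp
            rw [← pow_add, add_comm]
          rw [e3]
          have : H / L ≤ 1 / 2 := by
            rw [div_le_div_iff₀ hLpos two_pos, hL]
            have : 0 ≤ B / c := by positivity
            nlinarith
          gcongr
        rw [e]
        calc _ ≤ (m.choose (j + 1) : ℝ) * (B * H ^ (j + 1) * ((j + 1).factorial : ℝ) ^ s) *
              (c⁻¹ * L ^ (m - (j + 1)) * ((m - (j + 1)).factorial : ℝ) ^ s) := by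
              refine mul_le_mul ?_ (ih _ (by omega)) (norm_nonneg _) (by positivity)
              exact mul_le_mul_of_nonneg_left (hgB _ _) (by positivity)
          _ = B * c⁻¹ * (H ^ (j + 1) * L ^ (m - (j + 1))) * (((j + 1 + (m - (j + 1))).choose (j + 1) : ℝ) *
              (((j + 1).factorial : ℝ) ^ s * ((m - (j + 1)).factorial : ℝ) ^ s)) := by
              rw [hjm]; ring
          _ ≤ B * c⁻¹ * (L ^ m * (H / L * (1 / 2) ^ j)) *
              (((j + 1 + (m - (j + 1))).factorial : ℝ) ^ s) := by
              gcongr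
              exact choose_mul_factorial_rpow_le hs _ _
          _ = _ := by rw [hjm]
      rw [Finset.sum_range_succ'] at h2
      simp only [norm_iteratedFDeriv_zero, sub_self, norm_zero, mul_zero, zero_mul, add_zero] at h2
      have h4 := h2.trans (Finset.sum_le_sum h3)
      have h5 : ∑ j ∈ Finset.range m, B * c⁻¹ * (L ^ m * (H / L * (1 / 2) ^ j)) *
          (m.factorial : ℝ) ^ s ≤ L ^ m * (m.factorial : ℝ) ^ s := by
        have e4 : ∑ j ∈ Finset.range m, B * c⁻¹ * (L ^ m * (H / L * (1 / 2) ^ j)) *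
            (m.factorial : ℝ) ^ s =
            (B / c * (H / L) * ∑ j ∈ Finset.range m, (1 / 2 : ℝ) ^ j) * (L ^ m * (m.factorial : ℝ) ^ s) := by
          rw [Finset.mul_sum, Finset.sum_mul]
          exact Finset.sum_congr rfl fun j _ => by ring
        rw [e4]
        refine mul_le_of_le_one_left (by positivity) ?_
        calc B / c * (H / L) * ∑ j ∈ Finset.range m, (1 / 2 : ℝ) ^ j
            ≤ B / c * (H / L) * 2 := by gcongr; exact sum_geometric_two_le m
          _ = (B / c) / (1 + B / c) := by rw [hL]; field_simp
          _ ≤ 1 := by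
            rw [div_le_one (by positivity)]
            linarith
      have h6 : c * ‖iteratedFDeriv ℝ m (fun y => (g y)⁻¹) x‖ ≤ L ^ m * (m.factorial : ℝ) ^ s := by
        refine le_trans ?_ ((h1.le.trans h4).trans h5)
        gcongr
        exact hgc x
      rw [mul_assoc, inv_mul_eq_div, le_div_iff₀ hc]
      linarith
theorem GSBound.const_smul {s h A : ℝ} {f : V → F} (hf : GSBound s h A f)
    {𝕜 : Type*} [RCLike 𝕜] [NormedSpace 𝕜 F] [SMulCommClass ℝ 𝕜 F]
    (hfc : ContDiff ℝ ∞ f) (c : 𝕜) : GSBound s h (‖c‖ * A) (c • f) := by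
  intro k m x
  rw [iteratedFDeriv_const_smul_apply (hfc.of_le (mod_cast le_top)).contDiffAt, norm_smul]
  calc _ = ‖c‖ * (‖x‖ ^ k * ‖iteratedFDeriv ℝ m f x‖) := by ring
    _ ≤ ‖c‖ * (A * h ^ (k + m) * ((k.factorial : ℝ) * m.factorial) ^ s) :=
      mul_le_mul_of_nonneg_left (hf k m x) (norm_nonneg _)
    _ = _ := by ring

theorem GSBound.comp_equiv {s h A : ℝ} {f : V → F} (hf : GSBound s h A f)
    (hfc : ContDiff ℝ ∞ f) (g : V ≃L[ℝ] V) :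
    GSBound s (max ‖(g : V →L[ℝ] V)‖ ‖(g.symm : V →L[ℝ] V)‖ * h) A (f ∘ g) := by
  intro k m x
  set a := max ‖(g : V →L[ℝ] V)‖ ‖(g.symm : V →L[ℝ] V)‖
  have hA := hf.nonneg
  have ha : 0 ≤ a := (norm_nonneg _).trans (le_max_left _ _)
  have h1 : ‖x‖ ≤ a * ‖g x‖ := by
    have := (g.symm : V →L[ℝ] V).le_opNorm (g x)
    simp only [ContinuousLinearEquiv.coe_coe, ContinuousLinearEquiv.symm_apply_apply] at this
    refine this.trans ?_
    gcongr
    exact le_max_right _ _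
  have h2 : ‖iteratedFDeriv ℝ m (f ∘ g) x‖ ≤ ‖iteratedFDeriv ℝ m f (g x)‖ * a ^ m := by
    have := (g : V →L[ℝ] V).iteratedFDeriv_comp_right hfc x (i := m) (mod_cast le_top)
    rw [ContinuousLinearEquiv.coe_coe] at this
    rw [this]
    refine (ContinuousMultilinearMap.norm_compContinuousLinearMap_le _ _).trans ?_
    simp only [Finset.prod_const, Finset.card_univ, Fintype.card_fin]
    gcongr
    exact le_max_left _ _
  calc _ ≤ (a * ‖g x‖) ^ k * (‖iteratedFDeriv ℝ m f (g x)‖ * a ^ m) := by gcongr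
    _ = a ^ (k + m) * (‖g x‖ ^ k * ‖iteratedFDeriv ℝ m f (g x)‖) := by ring
    _ ≤ a ^ (k + m) * (A * h ^ (k + m) * ((k.factorial : ℝ) * m.factorial) ^ s) := by
        exact mul_le_mul_of_nonneg_left (hf _ _ _) (by positivity)
    _ = _ := by rw [mul_pow]; ring

end Bounds

section FourierBounds

open VectorFourier Real

variable {V : Type*} [NormedAddCommGroup V] [InnerProductSpace ℝ V]

theorem norm_iteratedFDeriv_fourierPowSMulRight_le {E : Type*} [NormedAddCommGroup E]
    [NormedSpace ℂ E] {f : V → E} (hf : ContDiff ℝ ∞ f) (n k : ℕ)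
    (v : V) :
    ‖iteratedFDeriv ℝ k (fun v ↦ fourierPowSMulRight (innerSL ℝ) f v n) v‖ ≤
      (2 * π) ^ n * ∑ i ∈ Finset.range (k + 1), (k.choose i : ℝ) * n.descFactorial i *
        (‖v‖ ^ (n - i) * ‖iteratedFDeriv ℝ (k - i) f v‖) := by
  let c : ℂ := (-(2 * π * Complex.I)) ^ n
  have hcomp : (fun v ↦ fourierPowSMulRight (innerSL ℝ) f v n) = fun v =>
      ContinuousMultilinearMap.smulRightL ℝ (fun _ : Fin n => V) E
        (ContinuousMultilinearMap.compContinuousLinearMapLRight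
          (ContinuousMultilinearMap.mkPiAlgebra ℝ (Fin n) ℝ) (fun _ => innerSL ℝ v)) (c • f v) := by
    funext v
    ext m
    simp only [fourierPowSMulRight_apply, ContinuousMultilinearMap.smulRightL_apply,
      ContinuousMultilinearMap.smulRight_apply,
      ContinuousMultilinearMap.compContinuousLinearMapLRight_apply,
      ContinuousMultilinearMap.compContinuousLinearMap_apply,
      ContinuousMultilinearMap.mkPiAlgebra_apply, c]
    rw [smul_comm]
  rw [hcomp]
  let L : V →L[ℝ] V →L[ℝ] ℝ := innerSL ℝ
  have hL : ‖L‖ ≤ 1 := norm_innerSL_le ℝ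
  let T : (V →L[ℝ] ℝ) [×n]→L[ℝ] (V [×n]→L[ℝ] ℝ) :=
    ContinuousMultilinearMap.compContinuousLinearMapLRight
      (ContinuousMultilinearMap.mkPiAlgebra ℝ (Fin n) ℝ)
  have I₁ m : ‖iteratedFDeriv ℝ m T (fun _ ↦ L v)‖ ≤
      n.descFactorial m * 1 * (‖L‖ * ‖v‖) ^ (n - m) := by
    have : ‖T‖ ≤ 1 := by
      apply (ContinuousMultilinearMap.norm_compContinuousLinearMapLRight_le _ _).trans
      simp only [ContinuousMultilinearMap.norm_mkPiAlgebra, le_refl]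
    apply (ContinuousMultilinearMap.norm_iteratedFDeriv_le _ _ _).trans
    simp only [Fintype.card_fin]
    gcongr
    refine (pi_norm_le_iff_of_nonneg (by positivity)).mpr (fun _ ↦ ?_)
    exact ContinuousLinearMap.le_opNorm _ _
  have I₂ m : ‖iteratedFDeriv ℝ m (T ∘ (ContinuousLinearMap.pi (fun (_ : Fin n) ↦ L))) v‖ ≤
      (n.descFactorial m * 1 * (‖L‖ * ‖v‖) ^ (n - m)) * ‖L‖ ^ m := by
    rw [ContinuousLinearMap.iteratedFDeriv_comp_right _ (ContinuousMultilinearMap.contDiff _)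
      _ (mod_cast le_top)]
    apply (ContinuousMultilinearMap.norm_compContinuousLinearMap_le _ _).trans
    simp only [Finset.prod_const, Finset.card_fin]
    gcongr
    · exact I₁ m
    · exact ContinuousLinearMap.norm_pi_le_of_le (fun _ ↦ le_rfl) (by positivity)
  have I₃ m : ‖iteratedFDeriv ℝ m (T ∘ (ContinuousLinearMap.pi (fun (_ : Fin n) ↦ L))) v‖ ≤
      n.descFactorial m * ‖v‖ ^ (n - m) := by
    apply (I₂ m).trans
    calc _ ≤ (n.descFactorial m * 1 * (1 * ‖v‖) ^ (n - m)) * 1 ^ m := by gcongr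
      _ = _ := by simp
  have A : ContDiff ℝ ∞ (fun y ↦ T (fun _ ↦ L y)) :=
    (ContinuousMultilinearMap.contDiff _).comp (contDiff_pi.2 fun _ ↦ L.contDiff)
  have hk : (k : WithTop ℕ∞) ≤ ((⊤ : ℕ∞) : WithTop ℕ∞) := mod_cast le_top
  have hcf : ContDiff ℝ ∞ (fun v => c • f v) := contDiff_const.smul hf
  have hcn (j : ℕ) : ‖iteratedFDeriv ℝ j (fun v => c • f v) v‖ =
      (2 * π) ^ n * ‖iteratedFDeriv ℝ j f v‖ := by
    rw [iteratedFDeriv_const_smul_apply' (hf.of_le (mod_cast le_top)).contDiffAt, norm_smul]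
    simp [c, abs_of_nonneg pi_nonneg]
  apply (ContinuousLinearMap.norm_iteratedFDeriv_le_of_bilinear_of_le_one _ A hcf _
    hk ContinuousMultilinearMap.norm_smulRightL_le).trans
  rw [Finset.mul_sum]
  refine Finset.sum_le_sum fun i _ => ?_
  rw [hcn]
  calc _ ≤ (k.choose i : ℝ) * (n.descFactorial i * ‖v‖ ^ (n - i)) *
        ((2 * π) ^ n * ‖iteratedFDeriv ℝ (k - i) f v‖) := by
        gcongr
        exact I₃ i
    _ = _ := by ring

variable [FiniteDimensional ℝ V] [MeasurableSpace V] [BorelSpace V]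

theorem pow_mul_norm_iteratedFDeriv_fourier_le_sum (f : 𝓢(V, ℂ)) (k n : ℕ) (w : V) :
    ‖w‖ ^ n * ‖iteratedFDeriv ℝ k (𝓕 (f : V → ℂ)) w‖ ≤
      (2 * π) ^ k * ∑ i ∈ Finset.range (n + 1), (n.choose i : ℝ) * k.descFactorial i *
        ∫ v, ‖v‖ ^ (k - i) * ‖iteratedFDeriv ℝ (n - i) f v‖ := by
  let L : V →L[ℝ] V →L[ℝ] ℝ := innerSL ℝ
  have hint : ∀ (k n : ℕ), Integrable (fun v ↦ ‖v‖ ^ k * ‖iteratedFDeriv ℝ n f v‖) :=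
    fun k n => f.integrable_pow_mul_iteratedFDeriv volume k n
  have key : ‖fourierPowSMulRight (-L.flip) (iteratedFDeriv ℝ k (𝓕 (f : V → ℂ))) w n‖ ≤
      (2 * π) ^ k * ∑ i ∈ Finset.range (n + 1), (n.choose i : ℝ) * k.descFactorial i *
        ∫ v, ‖v‖ ^ (k - i) * ‖iteratedFDeriv ℝ (n - i) f v‖ := by
    have e := VectorFourier.fourierPowSMulRight_iteratedFDeriv_fourierIntegral (μ := volume)
      (K := ⊤) (N := ⊤) L (f.smooth ⊤) (fun k n _ _ => hint k n) (k := k) (n := n)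
      le_top le_top (w := w)
    change ‖fourierPowSMulRight (-L.flip) (iteratedFDeriv ℝ k
      (VectorFourier.fourierIntegral 𝐞 volume L.toLinearMap₁₂ f)) w n‖ ≤ _
    rw [e]
    apply (norm_fourierIntegral_le_integral_norm _ _ _ _ _).trans
    have I : ∀ i ∈ Finset.range (n + 1), Integrable (fun v => (n.choose i : ℝ) * k.descFactorial i *
        (‖v‖ ^ (k - i) * ‖iteratedFDeriv ℝ (n - i) f v‖)) := fun i _ => (hint _ _).const_mul _
    calc _ ≤ ∫ v, (2 * π) ^ k * ∑ i ∈ Finset.range (n + 1), (n.choose i : ℝ) * k.descFactorial i *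
        (‖v‖ ^ (k - i) * ‖iteratedFDeriv ℝ (n - i) f v‖) := by
          apply integral_mono_of_nonneg
          · filter_upwards with v using norm_nonneg _
          · exact (integrable_finsetSum _ I).const_mul _
          · filter_upwards with v
            exact norm_iteratedFDeriv_fourierPowSMulRight_le (f.smooth ⊤) k n v
      _ = _ := by
          rw [integral_const_mul, integral_finsetSum _ I]
          simp_rw [integral_const_mul]
  have h1 : ‖w‖ ^ n * (‖w‖ ^ n * ‖iteratedFDeriv ℝ k (𝓕 (f : V → ℂ)) w‖) ≤
      ‖w‖ ^ n * ((2 * π) ^ k * ∑ i ∈ Finset.range (n + 1), (n.choose i : ℝ) * k.descFactorial i *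
        ∫ v, ‖v‖ ^ (k - i) * ‖iteratedFDeriv ℝ (n - i) f v‖) := by
    calc ‖w‖ ^ n * (‖w‖ ^ n * ‖iteratedFDeriv ℝ k (𝓕 (f : V → ℂ)) w‖)
        ≤ (2 * π) ^ n * (‖w‖ ^ n * (‖w‖ ^ n * ‖iteratedFDeriv ℝ k (𝓕 (f : V → ℂ)) w‖)) := by
          apply le_mul_of_one_le_left (by positivity)
          apply one_le_pow₀
          linarith [one_le_pi_div_two]
      _ = ‖fourierPowSMulRight (-L.flip)
            (iteratedFDeriv ℝ k (𝓕 (f : V → ℂ))) w n (fun _ ↦ w)‖ := by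
          have : ‖L w w‖ = ‖w‖ ^ 2 := by
            change ‖inner ℝ w w‖ = _
            rw [real_inner_self_eq_norm_sq]
            simp
          have e2 : ‖∏ _i : Fin n, (L w) w‖ = (‖w‖ ^ 2) ^ n := by
            rw [Finset.prod_const, norm_pow, this, Finset.card_univ, Fintype.card_fin]
          rw [fourierPowSMulRight_apply]
          simp only [neg_apply, ContinuousLinearMap.flip_apply,
            Finset.prod_neg, norm_smul, norm_mul, norm_pow, norm_neg, e2, norm_one,
            Complex.norm_ofNat, Complex.norm_real, Real.norm_eq_abs, abs_of_nonneg pi_nonneg,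
            Complex.norm_I]
          ring
      _ ≤ ‖fourierPowSMulRight (-L.flip)
            (iteratedFDeriv ℝ k (𝓕 (f : V → ℂ))) w n‖ * ∏ _ : Fin n, ‖w‖ :=
          ContinuousMultilinearMap.le_opNorm _ _
      _ ≤ _ := by
          rw [Finset.prod_const, Finset.card_univ, Fintype.card_fin, mul_comm]
          gcongr
  rcases eq_or_ne n 0 with rfl | hn
  · simpa using h1
  rcases eq_or_ne w 0 with rfl | hw
  · rw [norm_zero, zero_pow hn, zero_mul]
    refine mul_nonneg (by positivity) (Finset.sum_nonneg fun i _ => ?_)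
    exact mul_nonneg (by positivity) (integral_nonneg fun v => by positivity)
  exact le_of_mul_le_mul_left h1 (pow_pos (norm_pos_iff.mpr hw) n)

theorem exists_integral_bound (s h : ℝ) (hs : 0 ≤ s) (hh : 1 ≤ h) :
    ∃ h' ≥ 1, ∃ K ≥ 0, ∀ (A : ℝ) (f : V → ℂ), GSBound s h A f → ∀ a b : ℕ,
      ∫ v, ‖v‖ ^ a * ‖iteratedFDeriv ℝ b f v‖ ≤
        K * A * h' ^ (a + b) * ((a.factorial : ℝ) * b.factorial) ^ s := by
  let l := (volume : Measure V).integrablePower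
  let J := ∫ x : V, (1 + ‖x‖) ^ (- (l : ℝ))
  have hJ : 0 ≤ J := integral_nonneg fun x => by positivity
  have h2 : 1 ≤ (2 : ℝ) ^ s := Real.one_le_rpow one_le_two hs
  refine ⟨2 ^ s * h, by nlinarith, 2 ^ l * J * (1 + h ^ l * (2 ^ l * l.factorial : ℝ) ^ s),
    by positivity, fun A f hf a b => ?_⟩
  have hA := hf.nonneg
  have hbound := integral_pow_mul_le_of_le_of_pow_mul_le (μ := (volume : Measure V)) (k := a)
    (f := fun v => iteratedFDeriv ℝ b f v) (hf.deriv_le b) (fun x => hf _ b x)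
  refine hbound.trans ?_
  change 2 ^ l * J * _ ≤ _
  have hfac : (((a + l).factorial : ℝ) * b.factorial) ^ s ≤
      (2 ^ s) ^ (a + b) * ((2 ^ l * l.factorial : ℝ) ^ s * ((a.factorial : ℝ) * b.factorial) ^ s) := by
    have e : ((2 : ℝ) ^ s) ^ (a + b) = ((2 : ℝ) ^ (a + b)) ^ s := by
      rw [← Real.rpow_natCast, ← Real.rpow_natCast, ← Real.rpow_mul zero_le_two,
        ← Real.rpow_mul zero_le_two, mul_comm]
    rw [e, ← Real.mul_rpow (by positivity) (by positivity),
      ← Real.mul_rpow (by positivity) (by positivity)]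
    refine Real.rpow_le_rpow (by positivity) ?_ hs
    have c1 : ((a + l).factorial : ℝ) ≤ 2 ^ (a + l) * (a.factorial * l.factorial) := by
      rw [← Nat.add_choose_mul_factorial_mul_factorial a l]
      push_cast
      rw [mul_assoc]
      gcongr
      exact_mod_cast Nat.choose_le_two_pow _ _
    calc ((a + l).factorial : ℝ) * b.factorial ≤ (2 ^ (a + l) * (a.factorial * l.factorial)) * b.factorial := by
          gcongr
      _ = 2 ^ a * (2 ^ l * l.factorial * (a.factorial * b.factorial)) := by rw [pow_add]; ring
      _ ≤ _ := by
          gcongr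
          · norm_num
          · omega
  have hterm1 : A * h ^ b * (b.factorial : ℝ) ^ s ≤
      A * (2 ^ s * h) ^ (a + b) * ((a.factorial : ℝ) * b.factorial) ^ s := by
    have g1 : h ^ b ≤ (2 ^ s * h) ^ (a + b) :=
      calc h ^ b ≤ h ^ (a + b) := pow_le_pow_right₀ hh (by omega)
        _ ≤ _ := by
          gcongr
          nlinarith
    have g2 : (b.factorial : ℝ) ^ s ≤ ((a.factorial : ℝ) * b.factorial) ^ s := by
      gcongr
      exact le_mul_of_one_le_left (by positivity) (by exact_mod_cast Nat.factorial_pos a)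
    gcongr
  have hterm2 : A * h ^ (a + l + b) * (((a + l).factorial : ℝ) * b.factorial) ^ s ≤
      h ^ l * (2 ^ l * l.factorial : ℝ) ^ s *
        (A * (2 ^ s * h) ^ (a + b) * ((a.factorial : ℝ) * b.factorial) ^ s) := by
    calc _ ≤ A * h ^ (a + l + b) * ((2 ^ s) ^ (a + b) *
          ((2 ^ l * l.factorial : ℝ) ^ s * ((a.factorial : ℝ) * b.factorial) ^ s)) := by gcongr
      _ = _ := by
        rw [mul_pow, show a + l + b = l + (a + b) by omega, pow_add h l]
        ring
  calc _ ≤ 2 ^ l * J * (A * (2 ^ s * h) ^ (a + b) * ((a.factorial : ℝ) * b.factorial) ^ s +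
        h ^ l * (2 ^ l * l.factorial : ℝ) ^ s *
        (A * (2 ^ s * h) ^ (a + b) * ((a.factorial : ℝ) * b.factorial) ^ s)) := by
          gcongr
    _ = _ := by ring

theorem exists_fourier_bound (s h : ℝ) (hs : 1 ≤ s) (hh : 0 < h) :
    ∃ h' > 0, ∃ K ≥ 0, ∀ (A : ℝ) (f : 𝓢(V, ℂ)), GSBound s h A f →
      GSBound s h' (K * A) (𝓕 (f : V → ℂ)) := by
  obtain ⟨H, hH, K, hK, hint⟩ := exists_integral_bound (V := V) s (max h 1) (by linarith) (le_max_right _ _)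
  have hpi : (1 : ℝ) ≤ 2 * π := by linarith [one_le_pi_div_two]
  refine ⟨8 * π * H, by positivity, K, hK, fun A f hf n k w => ?_⟩
  have hf' := hf.mono hh.le (le_max_left h 1) le_rfl
  have hA := hf.nonneg
  refine (pow_mul_norm_iteratedFDeriv_fourier_le_sum f k n w).trans ?_
  have hterm : ∀ i ∈ Finset.range (n + 1), (n.choose i : ℝ) * k.descFactorial i *
        ∫ v, ‖v‖ ^ (k - i) * ‖iteratedFDeriv ℝ (n - i) f v‖ ≤
      (n.choose i : ℝ) * (K * A * (2 * H) ^ (n + k) * ((n.factorial : ℝ) * k.factorial) ^ s) := by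
    intro i hi
    have hin : i ≤ n := by
      have := Finset.mem_range.mp hi
      omega
    rw [mul_assoc]
    refine mul_le_mul_of_nonneg_left ?_ (by positivity)
    rcases lt_or_ge k i with hki | hki
    · rw [Nat.descFactorial_eq_zero_iff_lt.mpr hki]
      simp only [Nat.cast_zero, zero_mul]
      positivity
    have f1 : (k.descFactorial i : ℝ) * ((k - i).factorial : ℝ) ^ s ≤
        2 ^ k * (k.factorial : ℝ) ^ s := by
      have d : (k.descFactorial i : ℝ) = i.factorial * k.choose i := by
        rw [Nat.descFactorial_eq_factorial_mul_choose]
        push_cast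
        ring
      have d1 : (i.factorial : ℝ) ≤ (i.factorial : ℝ) ^ s :=
        Real.self_le_rpow_of_one_le (by exact_mod_cast Nat.factorial_pos i) hs
      have d2 : (k.choose i : ℝ) ≤ 2 ^ k := by exact_mod_cast Nat.choose_le_two_pow _ _
      calc _ = (k.choose i : ℝ) * (i.factorial * ((k - i).factorial : ℝ) ^ s) := by rw [d]; ring
        _ ≤ 2 ^ k * ((i.factorial : ℝ) ^ s * ((k - i).factorial : ℝ) ^ s) := by gcongr
        _ ≤ 2 ^ k * ((i + (k - i)).factorial : ℝ) ^ s := by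
            gcongr
            exact factorial_rpow_le (by linarith) _ _
        _ = _ := by rw [Nat.add_sub_cancel' hki]
    have f2 : ((n - i).factorial : ℝ) ^ s ≤ (n.factorial : ℝ) ^ s := by
      gcongr
      omega
    have f3 : H ^ (k - i + (n - i)) ≤ H ^ (n + k) := pow_le_pow_right₀ hH (by omega)
    have f4 : (2 : ℝ) ^ k ≤ 2 ^ (n + k) := pow_le_pow_right₀ one_le_two (by omega)
    calc _ ≤ (k.descFactorial i : ℝ) * (K * A * H ^ (k - i + (n - i)) *
          (((k - i).factorial : ℝ) * (n - i).factorial) ^ s) := by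
          gcongr
          exact hint A f hf' _ _
      _ = K * A * H ^ (k - i + (n - i)) * ((n - i).factorial : ℝ) ^ s *
          ((k.descFactorial i : ℝ) * ((k - i).factorial : ℝ) ^ s) := by
          rw [Real.mul_rpow (by positivity) (by positivity)]
          ring
      _ ≤ K * A * H ^ (n + k) * (n.factorial : ℝ) ^ s * (2 ^ (n + k) * (k.factorial : ℝ) ^ s) := by
          refine mul_le_mul ?_ (f1.trans ?_) (by positivity) (by positivity)
          · gcongr
          · gcongr
      _ = _ := by
          rw [mul_pow, Real.mul_rpow (by positivity) (by positivity)]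
          ring
  calc _ ≤ (2 * π) ^ k * ∑ i ∈ Finset.range (n + 1),
        (n.choose i : ℝ) * (K * A * (2 * H) ^ (n + k) * ((n.factorial : ℝ) * k.factorial) ^ s) := by
        exact mul_le_mul_of_nonneg_left (Finset.sum_le_sum hterm) (by positivity)
    _ = (2 * π) ^ k * 2 ^ n * (K * A * (2 * H) ^ (n + k) * ((n.factorial : ℝ) * k.factorial) ^ s) := by
        rw [← Finset.sum_mul, ← Nat.cast_sum, Nat.sum_range_choose]
        push_cast
        ring
    _ ≤ (2 * π) ^ (n + k) * 2 ^ (n + k) *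
        (K * A * (2 * H) ^ (n + k) * ((n.factorial : ℝ) * k.factorial) ^ s) := by
        gcongr ?_ * ?_ * _
        · exact pow_le_pow_right₀ hpi (by omega)
        · exact pow_le_pow_right₀ one_le_two (by omega)
    _ = _ := by
        rw [show 8 * π * H = (2 * π) * (2 * (2 * H)) by ring, mul_pow (2 * π), mul_pow 2 (2 * H)]
        ring

end FourierBounds

noncomputable section

/-- The Euclidean space `ℝⁿ`. -/
abbrev Rn (n : ℕ) := EuclideanSpace ℝ (Fin n)

/-- The Gelfand-Shilov space `S_s(ℝⁿ) = ⋃_{h > 0} S_{s,h}(ℝⁿ)`, as a space of Schwartz functions. -/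
def gelfandShilov (n : ℕ) (s : ℝ) : Submodule ℂ 𝓢(Rn n, ℂ) where
  carrier := {φ | ∃ h > 0, ∃ A, GSBound s h A φ}
  zero_mem' := ⟨1, one_pos, 0, fun k m x => by simp [Pi.zero_def]⟩
  add_mem' := by
    rintro φ ψ ⟨h₁, hh₁, A₁, H₁⟩ ⟨h₂, hh₂, A₂, H₂⟩
    refine ⟨max h₁ h₂, lt_max_of_lt_left hh₁, A₁ + A₂, fun k m x => ?_⟩
    have e : iteratedFDeriv ℝ m (⇑(φ + ψ)) x =
        iteratedFDeriv ℝ m φ x + iteratedFDeriv ℝ m ψ x :=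
      iteratedFDeriv_add_apply (φ.smooth m).contDiffAt (ψ.smooth m).contDiffAt
    have b₁ := H₁.mono hh₁.le (le_max_left h₁ h₂) le_rfl k m x
    have b₂ := H₂.mono hh₂.le (le_max_right h₁ h₂) le_rfl k m x
    calc _ ≤ ‖x‖ ^ k * (‖iteratedFDeriv ℝ m φ x‖ + ‖iteratedFDeriv ℝ m ψ x‖) := by
          rw [e]
          gcongr
          exact norm_add_le _ _
      _ ≤ _ := by
          rw [mul_add, add_mul, add_mul]
          exact add_le_add b₁ b₂
  smul_mem' := by
    rintro c φ ⟨h, hh, A, H⟩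
    exact ⟨h, hh, ‖c‖ * A, H.const_smul (φ.smooth ⊤) c⟩

/-- A linear operator on test functions that maps every `S_{s,h}` boundedly into some `S_{s,h'}`. -/
def IsGSBounded {n : ℕ} (s : ℝ) (M : 𝓢(Rn n, ℂ) →ₗ[ℂ] 𝓢(Rn n, ℂ)) : Prop :=
  ∀ h > 0, ∃ h' > 0, ∃ K ≥ 0, ∀ (A : ℝ) (φ : 𝓢(Rn n, ℂ)),
    GSBound s h A φ → GSBound s h' (K * A) (M φ)

theorem IsGSBounded.mem {n : ℕ} {s : ℝ} {M : 𝓢(Rn n, ℂ) →ₗ[ℂ] 𝓢(Rn n, ℂ)}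
    (hM : IsGSBounded s M) : ∀ φ ∈ gelfandShilov n s, M φ ∈ gelfandShilov n s := by
  rintro φ ⟨h, hh, A, hφ⟩
  obtain ⟨h', hh', K, -, H⟩ := hM h hh
  exact ⟨h', hh', _, H A φ hφ⟩

/-- The Gelfand-Shilov distributions `S_s'(ℝⁿ) = ⋂_{h > 0} (S_{s,h}(ℝⁿ))'`: the linear functionals on
`S_s` which, for every `h > 0`, satisfy `|f φ| ≤ C_h * ‖φ‖_{s,h}`. -/
def gelfandShilovDual (n : ℕ) (s : ℝ) : Submodule ℂ (gelfandShilov n s →ₗ[ℂ] ℂ) where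
  carrier := {f | ∀ h > 0, ∃ C, ∀ (A : ℝ) (φ : gelfandShilov n s),
    GSBound s h A (φ : 𝓢(Rn n, ℂ)) → ‖f φ‖ ≤ C * A}
  zero_mem' := fun h _ => ⟨0, fun A φ _ => by simp⟩
  add_mem' := by
    intro f g hf hg h hh
    obtain ⟨C, hC⟩ := hf h hh
    obtain ⟨D, hD⟩ := hg h hh
    refine ⟨C + D, fun A φ hφ => ?_⟩
    rw [add_mul]
    exact (norm_add_le _ _).trans (add_le_add (hC A φ hφ) (hD A φ hφ))
  smul_mem' := by
    intro c f hf h hh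
    obtain ⟨C, hC⟩ := hf h hh
    refine ⟨‖c‖ * C, fun A φ hφ => ?_⟩
    rw [LinearMap.smul_apply, norm_smul, mul_assoc]
    exact mul_le_mul_of_nonneg_left (hC A φ hφ) (norm_nonneg _)

/-- The transpose `⟨Mᵗ f, φ⟩ = ⟨f, M φ⟩` on `S_s'` of an operator `M` on test functions. -/
def transpose {n : ℕ} {s : ℝ} (M : 𝓢(Rn n, ℂ) →ₗ[ℂ] 𝓢(Rn n, ℂ)) (hM : IsGSBounded s M) :
    gelfandShilovDual n s →ₗ[ℂ] gelfandShilovDual n s where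
  toFun f := ⟨(f : gelfandShilov n s →ₗ[ℂ] ℂ) ∘ₗ M.restrict hM.mem, fun h hh => by
    obtain ⟨h', hh', K, -, H⟩ := hM h hh
    obtain ⟨C, hC⟩ := f.2 h' hh'
    exact ⟨C * K, fun A φ hφ => by
      rw [mul_assoc]
      exact hC _ _ (H A φ hφ)⟩⟩
  map_add' _ _ := rfl
  map_smul' _ _ := rfl

/-- The operator `φ ↦ (2π)^{-n/2} (𝓕 φ)(c ·)`, with Mathlib's Fourier transform `𝓕`. -/
def scaledFourier (n : ℕ) (c : ℝ) (hc : c ≠ 0) : 𝓢(Rn n, ℂ) →ₗ[ℂ] 𝓢(Rn n, ℂ) :=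
  (((2 * Real.pi) ^ (-(n : ℝ) / 2) : ℝ) : ℂ) •
    ((SchwartzMap.compCLMOfContinuousLinearEquiv ℂ
        (ContinuousLinearEquiv.smulLeft (R₁ := ℝ) (M₁ := Rn n) (Units.mk0 c hc))).toLinearMap ∘ₗ
      (FourierTransform.fourierCLM ℂ 𝓢(Rn n, ℂ)).toLinearMap)

theorem scaledFourier_apply (n : ℕ) (c : ℝ) (hc : c ≠ 0) (φ : 𝓢(Rn n, ℂ)) (ξ : Rn n) :
    scaledFourier n c hc φ ξ = (((2 * Real.pi) ^ (-(n : ℝ) / 2) : ℝ) : ℂ) *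
      ∫ x, Complex.exp (((-2 * Real.pi * c * inner ℝ x ξ : ℝ) : ℂ) * Complex.I) * φ x := by
  have : scaledFourier n c hc φ ξ = (((2 * Real.pi) ^ (-(n : ℝ) / 2) : ℝ) : ℂ) *
    𝓕 (φ : Rn n → ℂ) (c • ξ) := rfl
  rw [this, Real.fourier_eq']
  simp only [inner_smul_right, smul_eq_mul, mul_assoc]

theorem scaledFourier_isGSBounded (n : ℕ) (c : ℝ) (hc : c ≠ 0) {s : ℝ} (hs : 1 ≤ s) :
    IsGSBounded s (scaledFourier n c hc) := by
  intro h hh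
  obtain ⟨h', hh', K, hK, H⟩ := exists_fourier_bound (V := Rn n) s h hs hh
  let g : Rn n ≃L[ℝ] Rn n := ContinuousLinearEquiv.smulLeft (R₁ := ℝ) (M₁ := Rn n) (Units.mk0 c hc)
  let C : ℂ := (((2 * Real.pi) ^ (-(n : ℝ) / 2) : ℝ) : ℂ)
  refine ⟨max (max ‖(g : Rn n →L[ℝ] Rn n)‖ ‖(g.symm : Rn n →L[ℝ] Rn n)‖ * h') 1,
    lt_max_of_lt_right one_pos, ‖C‖ * K, by positivity, fun A φ hφ => ?_⟩
  have h1 := ((H A φ hφ).comp_equiv ((𝓕 φ : 𝓢(Rn n, ℂ)).smooth ⊤) g).const_smul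
    (((𝓕 φ : 𝓢(Rn n, ℂ)).smooth ⊤).comp g.contDiff) C
  rw [← mul_assoc] at h1
  exact h1.mono (by positivity) (le_max_left _ _) le_rfl

/-- The Fourier transform `φ̂ (ξ) = (2π)^{-n/2} ∫ φ(x) e^{-i x·ξ} dx` on test functions. -/
def fourierT (n : ℕ) : 𝓢(Rn n, ℂ) →ₗ[ℂ] 𝓢(Rn n, ℂ) :=
  scaledFourier n (2 * Real.pi)⁻¹ (by positivity)

theorem fourierT_apply (n : ℕ) (φ : 𝓢(Rn n, ℂ)) (ξ : Rn n) :
    fourierT n φ ξ = (((2 * Real.pi) ^ (-(n : ℝ) / 2) : ℝ) : ℂ) *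
      ∫ x, Complex.exp (-(Complex.I * (inner ℝ x ξ : ℝ))) * φ x := by
  rw [fourierT, scaledFourier_apply]
  congr! 5 with x
  have : -2 * Real.pi * (2 * Real.pi)⁻¹ * inner ℝ x ξ = -inner ℝ x ξ := by
    field_simp
  rw [this]
  push_cast
  ring

/-- The inverse Fourier transform `x ↦ (2π)^{-n/2} ∫ φ(ξ) e^{i x·ξ} dξ` on test functions. -/
def fourierTInv (n : ℕ) : 𝓢(Rn n, ℂ) →ₗ[ℂ] 𝓢(Rn n, ℂ) :=
  scaledFourier n (-(2 * Real.pi)⁻¹) (neg_ne_zero.mpr (by positivity))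

theorem fourierTInv_apply (n : ℕ) (φ : 𝓢(Rn n, ℂ)) (x : Rn n) :
    fourierTInv n φ x = (((2 * Real.pi) ^ (-(n : ℝ) / 2) : ℝ) : ℂ) *
      ∫ ξ, Complex.exp (Complex.I * (inner ℝ ξ x : ℝ)) * φ ξ := by
  rw [fourierTInv, scaledFourier_apply]
  congr! 5 with ξ
  have : -2 * Real.pi * -(2 * Real.pi)⁻¹ * inner ℝ ξ x = inner ℝ ξ x := by
    field_simp
  rw [this]
  ring

/-- The point of `ℤⁿ ⊆ ℝⁿ` with coordinates `k`. -/
def latticePoint {n : ℕ} (k : Fin n → ℤ) : Rn n := WithLp.toLp 2 fun i => (k i : ℝ)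

/-- The data of a frequency-uniform decomposition: a function `ρ : ℝⁿ → [0,1]` in `S_s`, supported in
the cube `[-1,1]ⁿ`, equal to `1` for `|ξ| ≤ 1/2`, and such that the sum of its translates `ρ(ξ - k)`
vanishes nowhere (so that one may divide by it). -/
structure FrequencyDecomposition (n : ℕ) (s : ℝ) where
  ρ : Rn n → ℝ
  smooth : ContDiff ℝ ∞ ρ
  gevrey : ∃ h > 0, ∃ A, GSBound s h A ρ
  nonneg : ∀ ξ, 0 ≤ ρ ξ
  le_one : ∀ ξ, ρ ξ ≤ 1
  eq_one : ∀ ξ, ‖ξ‖ ≤ 1 / 2 → ρ ξ = 1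
  support : ∀ ξ, ρ ξ ≠ 0 → ∀ i, |ξ i| ≤ 1
  exists_pos : ∀ ξ, ∃ k : Fin n → ℤ, 0 < ρ (ξ - latticePoint k)

namespace FrequencyDecomposition

variable {n : ℕ} {s : ℝ} (d : FrequencyDecomposition n s)

/-- `∑_j ρ(ξ - j)`, a locally finite sum over `j ∈ ℤⁿ`. -/
def sum (ξ : Rn n) : ℝ := ∑' j : Fin n → ℤ, d.ρ (ξ - latticePoint j)

/-- `σ_k(ξ) = ρ(ξ - k) / ∑_j ρ(ξ - j)`. -/
def σ (k : Fin n → ℤ) (ξ : Rn n) : ℝ := d.ρ (ξ - latticePoint k) / d.sum ξ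

/-- A finite set of indices `j` outside which `ρ(y - j) = 0` for all `y` near `x`. -/
def window (x : Rn n) : Finset (Fin n → ℤ) :=
  Fintype.piFinset fun i => Finset.Icc (⌊x i⌋ - 3) (⌊x i⌋ + 3)

theorem card_window (x : Rn n) : (window x).card = 7 ^ n := by
  rw [window, Fintype.card_piFinset]
  simp [show ∀ a : ℤ, a + 3 + 1 - (a - 3) = 7 by intro a; ring]

theorem eq_zero_of_notMem {x y : Rn n} (hxy : ‖y - x‖ < 1) {j : Fin n → ℤ} (hj : j ∉ window x) :
    d.ρ (y - latticePoint j) = 0 := by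
  by_contra hne
  apply hj
  rw [window, Fintype.mem_piFinset]
  intro i
  have h1 := abs_le.mp (d.support _ hne i)
  have h2 : |y i - x i| < 1 := (PiLp.norm_apply_le (y - x) i).trans_lt hxy
  have h2 := abs_lt.mp h2
  have h3 : (y - latticePoint j) i = y i - j i := rfl
  rw [h3] at h1
  have h4 := Int.floor_le (x i)
  have h5 := Int.lt_floor_add_one (x i)
  rw [Finset.mem_Icc]
  constructor
  · have : ((⌊x i⌋ - 3 : ℤ) : ℝ) ≤ j i := by push_cast; linarith
    exact_mod_cast this
  · have : (j i : ℝ) ≤ ((⌊x i⌋ + 3 : ℤ) : ℝ) := by push_cast; linarith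
    exact_mod_cast this

theorem sum_eq {x y : Rn n} (hxy : ‖y - x‖ < 1) :
    d.sum y = ∑ j ∈ window x, d.ρ (y - latticePoint j) :=
  tsum_eq_sum fun _ hj => d.eq_zero_of_notMem hxy hj

theorem sum_eventuallyEq (x : Rn n) :
    d.sum =ᶠ[nhds x] fun y => ∑ j ∈ window x, d.ρ (y - latticePoint j) := by
  filter_upwards [Metric.ball_mem_nhds x one_pos] with y hy
  exact d.sum_eq (by rwa [← dist_eq_norm])

theorem smooth_shift (j : Fin n → ℤ) : ContDiff ℝ ∞ fun y => d.ρ (y - latticePoint j) :=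
  d.smooth.comp (contDiff_id.sub contDiff_const)

theorem smooth_sum : ContDiff ℝ ∞ d.sum := by
  rw [contDiff_iff_contDiffAt]
  intro x
  refine ContDiffAt.congr_of_eventuallyEq ?_ (d.sum_eventuallyEq x)
  exact (ContDiff.sum fun j _ => d.smooth_shift j).contDiffAt

theorem sum_pos (x : Rn n) : 0 < d.sum x := by
  obtain ⟨k, hk⟩ := d.exists_pos x
  have hx : ‖x - x‖ < 1 := by simp
  rw [d.sum_eq hx]
  refine Finset.sum_pos' (fun j _ => d.nonneg _) ⟨k, ?_, hk⟩
  by_contra h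
  exact hk.ne' (d.eq_zero_of_notMem hx h)

theorem sum_add_latticePoint (k : Fin n → ℤ) (x : Rn n) : d.sum (x + latticePoint k) = d.sum x := by
  unfold sum
  rw [← (Equiv.addRight k).tsum_eq]
  refine tsum_congr fun j => ?_
  congr 1
  ext i
  simp [latticePoint]

theorem exists_sum_ge : ∃ c > 0, ∀ x, c ≤ d.sum x := by
  obtain ⟨y, -, hy⟩ := (isCompact_closedBall (0 : Rn n) (Real.sqrt n)).exists_isMinOn
    ⟨0, by simp⟩ d.smooth_sum.continuous.continuousOn
  refine ⟨d.sum y, d.sum_pos y, fun x => ?_⟩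
  let k : Fin n → ℤ := fun i => ⌊x i⌋
  have hx : x = (x - latticePoint k) + latticePoint k := by abel
  rw [hx, d.sum_add_latticePoint]
  apply isMinOn_iff.mp hy
  rw [mem_closedBall_zero_iff, EuclideanSpace.norm_eq]
  apply Real.sqrt_le_sqrt
  calc _ ≤ ∑ _i : Fin n, (1 : ℝ) := by
        refine Finset.sum_le_sum fun i _ => ?_
        have h3 : (x - latticePoint k) i = Int.fract (x i) := rfl
        rw [h3, Real.norm_of_nonneg (Int.fract_nonneg _)]
        exact pow_le_one₀ (Int.fract_nonneg _) (Int.fract_lt_one _).le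
    _ = n := by simp

theorem σ_bound (hs : 1 ≤ s) : ∃ H ≥ 1, ∃ B ≥ 0, ∀ k m x,
    ‖iteratedFDeriv ℝ m (d.σ k) x‖ ≤ B * H ^ m * (m.factorial : ℝ) ^ s := by
  obtain ⟨h, hh, A, hA⟩ := d.gevrey
  obtain ⟨c, hc, hcs⟩ := d.exists_sum_ge
  have hA0 := hA.nonneg
  have hshift (j : Fin n → ℤ) (m : ℕ) (x : Rn n) :
      ‖iteratedFDeriv ℝ m (fun y => d.ρ (y - latticePoint j)) x‖ ≤
        A * h ^ m * (m.factorial : ℝ) ^ s := by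
    rw [iteratedFDeriv_comp_sub]
    exact hA.deriv_le _ _
  have hsum (m : ℕ) (x : Rn n) : ‖iteratedFDeriv ℝ m d.sum x‖ ≤
      (7 ^ n * A) * h ^ m * (m.factorial : ℝ) ^ s := by
    rw [((d.sum_eventuallyEq x).iteratedFDeriv ℝ m).eq_of_nhds,
      iteratedFDeriv_fun_sum_apply fun j _ => ((d.smooth_shift j).of_le (mod_cast le_top)).contDiffAt]
    refine (norm_sum_le _ _).trans ((Finset.sum_le_sum fun j _ => hshift j m x).trans ?_)
    rw [Finset.sum_const, card_window, nsmul_eq_mul]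
    push_cast
    exact le_of_eq (by ring)
  set B := 7 ^ n * A
  have hB0 : 0 ≤ B := by positivity
  have hinv := inv_deriv_le hs hc hh hB0 d.smooth_sum hcs hsum
  set L := 2 * h * (1 + B / c)
  have hL : 0 < L := by positivity
  have hhL : h ≤ L := by
    have : 0 ≤ B / c := by positivity
    nlinarith
  refine ⟨max (2 * L) 1, le_max_right _ _, c⁻¹ * A, by positivity, fun k m x => ?_⟩
  have h1 := norm_iteratedFDeriv_mul_le (d.smooth_shift k)
    (d.smooth_sum.inv fun y => (d.sum_pos y).ne') x (n := m) (mod_cast le_top)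
  have h2 := leibniz_sum_le (s := s) (by linarith) (A := c⁻¹) (B := A) (H := L) (by positivity) hA0 hL.le
    (fun j => ‖iteratedFDeriv ℝ j (fun y => d.ρ (y - latticePoint k)) x‖)
    (fun j => ‖iteratedFDeriv ℝ j (fun y => (d.sum y)⁻¹) x‖)
    (fun j => (hshift k j x).trans (by gcongr)) (fun j => norm_nonneg _) (fun j => hinv j x) m
  have e : d.σ k = fun y => d.ρ (y - latticePoint k) * (d.sum y)⁻¹ := by
    funext y
    rw [σ, div_eq_mul_inv]
  rw [e]
  refine (h1.trans h2).trans ?_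
  gcongr
  exact le_max_left _ _

theorem smooth_σ (k : Fin n → ℤ) : ContDiff ℝ ∞ (d.σ k) :=
  (d.smooth_shift k).div d.smooth_sum fun y => (d.sum_pos y).ne'

theorem smooth_ofReal_σ (k : Fin n → ℤ) : ContDiff ℝ ∞ fun ξ => (d.σ k ξ : ℂ) :=
  Complex.ofRealCLM.contDiff.comp (d.smooth_σ k)

theorem norm_iteratedFDeriv_ofReal_σ (k : Fin n → ℤ) (m : ℕ) (x : Rn n) :
    ‖iteratedFDeriv ℝ m (fun ξ => (d.σ k ξ : ℂ)) x‖ = ‖iteratedFDeriv ℝ m (d.σ k) x‖ :=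
  Complex.ofRealLI.norm_iteratedFDeriv_comp_left (d.smooth_σ k).contDiffAt (mod_cast le_top)

/-- Multiplication of test functions by `σ_k`. -/
def mulσ (k : Fin n → ℤ) : 𝓢(Rn n, ℂ) →ₗ[ℂ] 𝓢(Rn n, ℂ) :=
  (SchwartzMap.smulLeftCLM ℂ fun ξ => (d.σ k ξ : ℂ)).toLinearMap

theorem hasTemperateGrowth_σ (hs : 1 ≤ s) (k : Fin n → ℤ) :
    Function.HasTemperateGrowth fun ξ => (d.σ k ξ : ℂ) := by
  obtain ⟨H, hH, B, hB, hσ⟩ := d.σ_bound hs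
  refine ⟨d.smooth_ofReal_σ k, fun m => ⟨0, B * H ^ m * (m.factorial : ℝ) ^ s, fun x => ?_⟩⟩
  rw [d.norm_iteratedFDeriv_ofReal_σ, pow_zero, mul_one]
  exact hσ k m x

theorem mulσ_apply (hs : 1 ≤ s) (k : Fin n → ℤ) (φ : 𝓢(Rn n, ℂ)) (ξ : Rn n) :
    d.mulσ k φ ξ = d.σ k ξ * φ ξ :=
  SchwartzMap.smulLeftCLM_apply_apply (d.hasTemperateGrowth_σ hs k) φ ξ

theorem mulσ_isGSBounded (hs : 1 ≤ s) (k : Fin n → ℤ) : IsGSBounded s (d.mulσ k) := by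
  obtain ⟨H, hH, B, hB, hσ⟩ := d.σ_bound hs
  intro h hh
  refine ⟨2 * max H h, by positivity, B, hB, fun A φ hφ => ?_⟩
  have := hφ.smul_left (H := max H h) (by linarith) hh.le (hH.trans (le_max_left _ _))
    (le_max_right _ _) (φ.smooth ⊤) (d.smooth_ofReal_σ k) hB fun m x => by
      rw [d.norm_iteratedFDeriv_ofReal_σ]
      refine (hσ k m x).trans ?_
      gcongr
      exact le_max_left _ _
  have e : ⇑(d.mulσ k φ) = fun ξ => (d.σ k ξ : ℂ) • φ ξ := funext fun ξ => d.mulσ_apply hs k φ ξ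
  rw [e]
  exact this

end FrequencyDecomposition

section Spaces

variable {n : ℕ} {s : ℝ}

/-- The Fourier transform on `S_s'`, `⟨f̂, φ⟩ = ⟨f, φ̂⟩`. -/
def fourierDual (hs : 1 < s) : gelfandShilovDual n s →ₗ[ℂ] gelfandShilovDual n s :=
  transpose (fourierT n) (scaledFourier_isGSBounded n _ _ hs.le)

/-- The inverse Fourier transform on `S_s'`, by duality. -/
def fourierInvDual (hs : 1 < s) : gelfandShilovDual n s →ₗ[ℂ] gelfandShilovDual n s :=
  transpose (fourierTInv n) (scaledFourier_isGSBounded n _ _ hs.le)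

/-- The uniform decomposition operator `□_k f = 𝓕⁻¹ (σ_k 𝓕 f)` on `S_s'`. -/
def box (hs : 1 < s) (d : FrequencyDecomposition n s) (k : Fin n → ℤ)
    (f : gelfandShilovDual n s) : gelfandShilovDual n s :=
  fourierInvDual hs (transpose (d.mulσ k) (d.mulσ_isGSBounded hs.le k) (fourierDual hs f))

/-- The distribution `f` is given by the function `u`: `⟨f, φ⟩ = ∫ u φ` for all `φ ∈ S_s`. -/
def Represents (u : Rn n → ℂ) (f : gelfandShilovDual n s) : Prop :=
  ∀ φ : gelfandShilov n s, (f : gelfandShilov n s →ₗ[ℂ] ℂ) φ = ∫ x, u x * (φ : 𝓢(Rn n, ℂ)) x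

/-- The `L^p` norm of a distribution: the `L^p` norm of the function in `L^p` that represents it,
and `∞` if there is no such function. -/
def lpNorm (p : ℝ≥0∞) (f : gelfandShilovDual n s) : ℝ≥0∞ :=
  ⨅ (u : Rn n → ℂ) (_ : MemLp u p volume ∧ Represents u f), eLpNorm u p volume

/-- The norm `(∑_k (e^{|k|^{1/s}} ‖□_k f‖_{L^p})^q)^{1/q}`, a supremum if `q = ∞`. -/
def gmNorm (hs : 1 < s) (d : FrequencyDecomposition n s) (p q : ℝ≥0∞)
    (f : gelfandShilovDual n s) : ℝ≥0∞ :=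
  if q = ⊤ then
    ⨆ k : Fin n → ℤ, ENNReal.ofReal (Real.exp (‖latticePoint k‖ ^ (1 / s))) * lpNorm p (box hs d k f)
  else
    (∑' k : Fin n → ℤ, (ENNReal.ofReal (Real.exp (‖latticePoint k‖ ^ (1 / s))) *
      lpNorm p (box hs d k f)) ^ q.toReal) ^ (1 / q.toReal)

/-- The Gevrey-modulation space `GM^{p,q}_s(ℝⁿ)`. -/
def gevreyModulation (hs : 1 < s) (d : FrequencyDecomposition n s) (p q : ℝ≥0∞) :
    Set (gelfandShilovDual n s) :=
  {f | gmNorm hs d p q f < ⊤}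

/-- `h` is the product `f g`: the distributions `f` and `g` are essentially bounded functions, and `h`
is given by their pointwise product. -/
def IsProduct (f g h : gelfandShilovDual n s) : Prop :=
  ∃ u v : Rn n → ℂ, MemLp u ⊤ volume ∧ MemLp v ⊤ volume ∧
    Represents u f ∧ Represents v g ∧ Represents (fun x => u x * v x) h

end Spaces

end

end GevreyModulation

open GevreyModulation

/-! Write θ = 1/s, so that 0 < θ < 1. Each σ_k is an integer translate of σ_0, so □_k is convolution
with a modulation of one fixed Schwartz kernel, and the constants below do not depend on k. The σ_k
form a partition of unity of which only boundedly many members meet the support of σ_l. Hence a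
piece □_l f reproduces itself under convolution with the sum of the neighbouring kernels
(`exists_represents_box`), and Hölder's inequality turns this into Bernstein's inequality ‖□_l f‖_∞
≤ C ‖□_l f‖_r (`enorm_reproduce_le`). Finiteness of the norm forces ‖□_l f‖_r ≤ ‖f‖ e^{-|l|^θ},
which is summable in l, so f is a bounded function, the uniformly convergent sum of its pieces
(`exists_dominatedFamily`). Products are therefore pointwise. They are unambiguous because a locally
integrable function is determined almost everywhere by its integrals against S_s
(`ae_eq_zero_of_forall_integral_eq_zero`).

Frequencies add under multiplication: if u_l, v_m are pieces of f, g, then □_k(u_l v_m) = 0 unless k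
- l - m lies in a fixed finite cube R. So ‖□_k(fg)‖_p is at most a constant times Σ_{j∈R} Σ_l ‖□_l
f‖_r ‖□_{k-j-l} g‖_r (`DominatedFamily.eLpNorm_conv_mul_le`), as soon as ‖u_l v_m‖_p ≤ D ‖u_l‖_r
‖v_m‖_r.

Submultiplicativity of the weight e^{|k|^θ} alone would not control this convolution of two ℓ^q
sequences when q > 1. Concavity of t^θ yields more: a gain e^{-c min(|l|,|m|)^θ} with c = 2 - 2^θ >
0 (`add_rpow_add_min_rpow_le`). The gain makes one of the two weighted sequences summable, and
Young's inequality ℓ¹ * ℓ^q ⊆ ℓ^q concludes (`eLpNorm_weight_mul_conv_le`).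

The two estimates of the theorem differ only in how a single product u_l v_m is bounded: by Hölder
with exponents 2p, 2p, or by L^∞ · L^p together with Bernstein. -/

namespace GevreyModulation

/-! ### Young's inequality on an additive group, used both on ℝⁿ and on ℤⁿ. -/

section Young

variable {G : Type*} [AddCommGroup G] [MeasurableSpace G] [MeasurableAdd₂ G] [MeasurableNeg G]
  {μ : Measure G} [SFinite μ] [μ.IsAddLeftInvariant] [μ.IsNegInvariant]

/-- Comparison of the L¹ and L^p norms of w for the finite or infinite measure a dν. -/
theorem lintegral_mul_le_rpow_mul_rpow {α : Type*} [MeasurableSpace α] {ν : Measure α}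
    {a w : α → ℝ≥0∞} (ha : Measurable a) (hw : AEMeasurable w ν) {p : ℝ} (hp : 1 ≤ p) :
    ∫⁻ y, a y * w y ∂ν ≤ (∫⁻ y, a y * w y ^ p ∂ν) ^ (1 / p) * (∫⁻ y, a y ∂ν) ^ (1 - 1 / p) := by
  have hw' : AEMeasurable w (ν.withDensity a) := hw.mono_ac (withDensity_absolutelyContinuous _ _)
  have h := eLpNorm'_le_eLpNorm'_mul_rpow_measure_univ (μ := ν.withDensity a) (f := w)
    one_pos hp hw'.aestronglyMeasurable
  simp only [eLpNorm', ENNReal.rpow_one, one_div, inv_one, enorm_eq_self,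
    withDensity_apply _ MeasurableSet.univ, Measure.restrict_univ] at h
  rw [lintegral_withDensity_eq_lintegral_mul₀ ha.aemeasurable hw,
    lintegral_withDensity_eq_lintegral_mul₀ ha.aemeasurable (hw.pow_const p)] at h
  simpa using! h

/-- **Young's convolution inequality** `L¹ * L^p ⊆ L^p`. -/
theorem eLpNorm_lintegral_sub_mul_le {a w : G → ℝ≥0∞} (ha : Measurable a) (hw : AEMeasurable w μ)
    {p : ℝ≥0∞} (hp : 1 ≤ p) :
    eLpNorm (fun x => ∫⁻ y, a (x - y) * w y ∂μ) p μ ≤ (∫⁻ y, a y ∂μ) * eLpNorm w p μ := by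
  have hax (x : G) : Measurable fun y => a (x - y) := ha.comp (measurable_const.sub measurable_id)
  have hA (x : G) : ∫⁻ y, a (x - y) ∂μ = ∫⁻ y, a y ∂μ := lintegral_sub_left_eq_self a x
  have hA' (y : G) : ∫⁻ x, a (x - y) ∂μ = ∫⁻ y, a y ∂μ := lintegral_sub_right_eq_self a y
  rcases eq_or_ne p ⊤ with rfl | hpt
  · rw [eLpNorm_exponent_top, eLpNorm_exponent_top]
    refine essSup_le_of_ae_le _ (.of_forall fun x => ?_)
    simp only [enorm_eq_self]
    calc ∫⁻ y, a (x - y) * w y ∂μ ≤ ∫⁻ y, a (x - y) * eLpNormEssSup w μ ∂μ := by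
          refine lintegral_mono_ae ?_
          filter_upwards [enorm_ae_le_eLpNormEssSup w μ] with y hy
          gcongr
          exact hy
      _ = _ := by rw [lintegral_mul_const _ (hax x), hA]
  have hp0 : p ≠ 0 := (one_pos.trans_le hp).ne'
  have hp1 : 1 ≤ p.toReal := by
    rw [← ENNReal.toReal_one]
    exact ENNReal.toReal_mono hpt hp
  rw [eLpNorm_eq_lintegral_rpow_enorm_toReal hp0 hpt, eLpNorm_eq_lintegral_rpow_enorm_toReal hp0 hpt]
  simp only [enorm_eq_self]
  set r := p.toReal
  set A := ∫⁻ y, a y ∂μ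
  have hr : 0 < r := one_pos.trans_le hp1
  -- The previous lemma for the weight a(x - ·), whose total mass is A for every x. Integrating in x
  -- by Tonelli gives one more factor A, hence A ^ r in all.
  have hpt (x : G) : (∫⁻ y, a (x - y) * w y ∂μ) ^ r ≤
      (∫⁻ y, a (x - y) * w y ^ r ∂μ) * A ^ (r - 1) := by
    calc _ ≤ ((∫⁻ y, a (x - y) * w y ^ r ∂μ) ^ (1 / r) * (∫⁻ y, a (x - y) ∂μ) ^ (1 - 1 / r)) ^ r := by
          gcongr
          exact lintegral_mul_le_rpow_mul_rpow (hax x) hw hp1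
      _ = _ := by
          rw [hA, ENNReal.mul_rpow_of_nonneg _ _ hr.le, ← ENNReal.rpow_mul, ← ENNReal.rpow_mul]
          congr 2
          · rw [one_div_mul_cancel hr.ne', ENNReal.rpow_one]
          · field_simp
  have hmeas : AEMeasurable (Function.uncurry fun x y => a (x - y) * w y ^ r) (μ.prod μ) :=
    ((ha.comp (measurable_fst.sub measurable_snd)).aemeasurable).mul
      ((hw.comp_quasiMeasurePreserving Measure.quasiMeasurePreserving_snd).pow_const r)
  calc _ ≤ (∫⁻ x, (∫⁻ y, a (x - y) * w y ^ r ∂μ) * A ^ (r - 1) ∂μ) ^ (1 / r) := by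
        gcongr with x
        exact hpt x
    _ = ((A * ∫⁻ y, w y ^ r ∂μ) * A ^ (r - 1)) ^ (1 / r) := by
        congr 1
        have hm1 : AEMeasurable (fun x => ∫⁻ y, a (x - y) * w y ^ r ∂μ) μ :=
          hmeas.lintegral_prod_right'
        rw [lintegral_mul_const'' _ hm1, lintegral_lintegral_swap hmeas]
        congr 1
        rw [← lintegral_const_mul'' _ (hw.pow_const r)]
        refine lintegral_congr fun y => ?_
        have : Measurable fun x => a (x - y) := ha.comp (measurable_id.sub measurable_const)
        rw [lintegral_mul_const _ this, hA']
    _ = (A ^ r * ∫⁻ y, w y ^ r ∂μ) ^ (1 / r) := by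
        congr 1
        have : A ^ r = A * A ^ (r - 1) := by
          conv_lhs => rw [show r = 1 + (r - 1) by ring,
            ENNReal.rpow_add_of_nonneg _ _ zero_le_one (by linarith), ENNReal.rpow_one]
        rw [this]
        ring
    _ = _ := by
        rw [ENNReal.mul_rpow_of_nonneg _ _ (by positivity), ← ENNReal.rpow_mul,
          mul_one_div_cancel hr.ne', ENNReal.rpow_one]

end Young

/-! ### Subadditivity of the weight exponent, with a gain, and summability of its inverse. -/

section Weights

/-- A quantitative form of the subadditivity of `t ↦ t ^ θ`. -/
theorem add_rpow_add_min_rpow_le {θ a b : ℝ} (h0 : 0 < θ) (h1 : θ ≤ 1) (ha : 0 ≤ a) (hb : 0 ≤ b) :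
    (a + b) ^ θ + (2 - 2 ^ θ) * (min a b) ^ θ ≤ a ^ θ + b ^ θ := by
  wlog hab : b ≤ a generalizing a b
  · have := this hb ha (le_of_not_ge hab)
    rwa [add_comm b a, min_comm, add_comm (b ^ θ)] at this
  rw [min_eq_right hab]
  rcases hb.eq_or_lt with rfl | hb
  · simp [Real.zero_rpow h0.ne']
  have ha : 0 < a := hb.trans_le hab
  have hc := Real.concaveOn_rpow h0.le h1
  have ht : b / a ≤ 1 := (div_le_one ha).mpr hab
  have hab' : a + b ∈ Set.Ici (0 : ℝ) := (add_pos ha hb).le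
  have hb' : b ∈ Set.Ici (0 : ℝ) := hb.le
  have ht0 : 0 ≤ b / a := by positivity
  -- With t = b / a, both 2b and a are convex combinations of b and a + b, with the weights t and 1
  -- - t interchanged. Adding the two concavity inequalities removes t.
  have k1 := hc.2 hb' hab' (sub_nonneg.mpr ht) ht0 (by ring)
  have k2 := hc.2 hb' hab' ht0 (sub_nonneg.mpr ht) (by ring)
  simp only [smul_eq_mul] at k1 k2
  have e1 : (1 - b / a) * b + b / a * (a + b) = 2 * b := by field_simp; ring
  have e2 : b / a * b + (1 - b / a) * (a + b) = a := by field_simp; ring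
  rw [e1, Real.mul_rpow two_pos.le hb.le] at k1
  rw [e2] at k2
  linarith

/-- The shift r is a bounded error and costs only its own weight. The gain in min(‖l‖, ‖m‖) is
replaced by a sum of two exponentials, each depending on one variable, so that the two resulting
convolutions can be treated separately. -/
theorem exp_rpow_norm_le {V : Type*} [SeminormedAddCommGroup V] {θ : ℝ} (h0 : 0 < θ) (h1 : θ ≤ 1)
    (l m r : V) : Real.exp (‖l + m + r‖ ^ θ) ≤ Real.exp (‖r‖ ^ θ) *
      (Real.exp (‖l‖ ^ θ) * Real.exp (‖m‖ ^ θ) *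
        (Real.exp (-(2 - 2 ^ θ) * ‖l‖ ^ θ) + Real.exp (-(2 - 2 ^ θ) * ‖m‖ ^ θ))) := by
  have k1 : ‖l + m + r‖ ^ θ ≤ (‖l‖ + ‖m‖) ^ θ + ‖r‖ ^ θ :=
    (Real.rpow_le_rpow (norm_nonneg _) ((norm_add_le _ _).trans
      (add_le_add_left (norm_add_le l m) _)) h0.le).trans
      (Real.rpow_add_le_add_rpow (by positivity) (norm_nonneg _) h0.le h1)
  have k2 := add_rpow_add_min_rpow_le h0 h1 (norm_nonneg l) (norm_nonneg m)
  have k3 : Real.exp (-(2 - 2 ^ θ) * (min ‖l‖ ‖m‖) ^ θ) ≤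
      Real.exp (-(2 - 2 ^ θ) * ‖l‖ ^ θ) + Real.exp (-(2 - 2 ^ θ) * ‖m‖ ^ θ) := by
    rcases min_choice ‖l‖ ‖m‖ with h | h <;> rw [h]
    · linarith [Real.exp_pos (-(2 - 2 ^ θ) * ‖m‖ ^ θ)]
    · linarith [Real.exp_pos (-(2 - 2 ^ θ) * ‖l‖ ^ θ)]
  calc _ ≤ Real.exp (‖r‖ ^ θ + ((‖l‖ ^ θ + ‖m‖ ^ θ) + -(2 - 2 ^ θ) * (min ‖l‖ ‖m‖) ^ θ)) := by
        apply Real.exp_le_exp.mpr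
        linarith
    _ = Real.exp (‖r‖ ^ θ) * (Real.exp (‖l‖ ^ θ) * Real.exp (‖m‖ ^ θ) *
        Real.exp (-(2 - 2 ^ θ) * (min ‖l‖ ‖m‖) ^ θ)) := by
        rw [Real.exp_add, Real.exp_add, Real.exp_add]
    _ ≤ _ := by gcongr

theorem latticePoint_add {n : ℕ} (k l : Fin n → ℤ) :
    latticePoint (k + l) = latticePoint k + latticePoint l := by
  ext i
  simp [latticePoint]

theorem latticePoint_injective {n : ℕ} : Function.Injective (latticePoint (n := n)) := by
  intro k l h
  funext i
  have := congrArg (fun v : Rn n => v i) h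
  simpa [latticePoint] using this

/-- The exponential beats every power: e^{-x} ≤ M! / x^M reduces the claim to summability of a
negative power of the norm over a lattice, once θ M exceeds the rank. -/
theorem summable_exp_neg_norm_rpow (n : ℕ) {c θ : ℝ} (hc : 0 < c) (h0 : 0 < θ) :
    Summable fun k : Fin n → ℤ => Real.exp (-c * ‖latticePoint k‖ ^ θ) := by
  let b := (EuclideanSpace.basisFun (Fin n) ℝ).toBasis
  let L : Submodule ℤ (Rn n) := Submodule.span ℤ (Set.range b)
  have hmem (k : Fin n → ℤ) : latticePoint k ∈ L := by
    have : latticePoint k = ∑ i, k i • b i := by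
      ext j
      simp [latticePoint, b, Finset.sum_apply, Pi.single_apply]
    rw [this]
    exact Submodule.sum_mem _ fun i _ => Submodule.smul_mem _ _ (Submodule.subset_span ⟨i, rfl⟩)
  obtain ⟨M, hM⟩ := exists_nat_gt ((Module.finrank ℤ L : ℝ) / θ)
  have hM' : -(θ * M) < -(Module.finrank ℤ L : ℝ) := by
    rw [div_lt_iff₀ h0] at hM
    linarith
  have hsum := (ZLattice.summable_norm_rpow L (-(θ * M)) hM').comp_injective
    (i := fun k : Fin n → ℤ => (⟨latticePoint k, hmem k⟩ : L))
    fun k l h => latticePoint_injective (congrArg Subtype.val h)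
  -- The comparison fails at k = 0, where the negative power of the norm has the default value 0, so
  -- it is required off that point only.
  refine Summable.of_norm_bounded_eventually (hsum.mul_left (M.factorial * (c ^ M)⁻¹)) ?_
  refine (Set.finite_singleton (0 : Fin n → ℤ)).subset fun k hk => ?_
  by_contra hk0
  apply hk
  have hpos : 0 < ‖latticePoint k‖ := by
    rw [norm_pos_iff]
    intro h
    apply hk0
    exact latticePoint_injective (h.trans (by ext i; simp [latticePoint]))
  have hx : 0 < c * ‖latticePoint k‖ ^ θ := by positivity
  have h := Real.pow_div_factorial_le_exp _ hx.le M
  change ‖Real.exp (-c * ‖latticePoint k‖ ^ θ)‖ ≤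
    M.factorial * (c ^ M)⁻¹ * ‖latticePoint k‖ ^ (-(θ * M))
  rw [Real.norm_of_nonneg (Real.exp_pos _).le, neg_mul, Real.exp_neg]
  rw [Real.rpow_neg hpos.le, Real.rpow_mul hpos.le, Real.rpow_natCast]
  calc (Real.exp (c * ‖latticePoint k‖ ^ θ))⁻¹ ≤ ((c * ‖latticePoint k‖ ^ θ) ^ M / M.factorial)⁻¹ := by
        gcongr
    _ = _ := by
        rw [mul_pow]
        field_simp

end Weights

end GevreyModulation
namespace GevreyModulation

/-! ### Convolution on ℝⁿ with continuous kernels. -/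

section Convolution

variable {n : ℕ}

/-- The convolution `(K * u)(x) = ∫ K(x - y) u(y) dy`. -/
noncomputable def conv (K u : Rn n → ℂ) (x : Rn n) : ℂ := ∫ y, K (x - y) * u y

theorem aestronglyMeasurable_sub_mul {K u : Rn n → ℂ} (hK : Continuous K)
    (hu : AEStronglyMeasurable u) :
    AEStronglyMeasurable (fun z : Rn n × Rn n => K (z.1 - z.2) * u z.2) (volume.prod volume) :=
  (hK.comp (continuous_fst.sub continuous_snd)).aestronglyMeasurable.mul
    (hu.comp_quasiMeasurePreserving Measure.quasiMeasurePreserving_snd)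

theorem aestronglyMeasurable_conv {K u : Rn n → ℂ} (hK : Continuous K)
    (hu : AEStronglyMeasurable u) : AEStronglyMeasurable (conv K u) :=
  (aestronglyMeasurable_sub_mul hK hu).integral_prod_right'

theorem eLpNorm_comp_sub_left (p : ℝ≥0∞) {K : Rn n → ℂ} (hK : AEStronglyMeasurable K) (x : Rn n) :
    eLpNorm (fun y => K (x - y)) p volume = eLpNorm K p volume :=
  eLpNorm_comp_measurePreserving hK (Measure.measurePreserving_sub_left volume x)

theorem eLpNorm_comp_sub_right (p : ℝ≥0∞) {K : Rn n → ℂ} (hK : AEStronglyMeasurable K) (x : Rn n) :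
    eLpNorm (fun y => K (y - x)) p volume = eLpNorm K p volume :=
  eLpNorm_comp_measurePreserving hK (measurePreserving_sub_right volume x)

theorem lintegral_enorm_mul_le {p p' : ℝ≥0∞} [p'.HolderConjugate p] {a u : Rn n → ℂ}
    (ha : AEStronglyMeasurable a) (hu : AEStronglyMeasurable u) :
    ∫⁻ x, ‖a x * u x‖ₑ ≤ eLpNorm a p' volume * eLpNorm u p volume := by
  have := eLpNorm_smul_le_mul_eLpNorm (p := p') (q := p) (r := 1) hu ha
  rwa [eLpNorm_one_eq_lintegral_enorm] at this

/-- Hölder at each fixed x. Applied to a reproducing kernel, this becomes Bernstein's inequality. -/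
theorem enorm_conv_le {p p' : ℝ≥0∞} [p'.HolderConjugate p] {K u : Rn n → ℂ}
    (hK : Continuous K) (hu : AEStronglyMeasurable u) (x : Rn n) :
    ‖conv K u x‖ₑ ≤ eLpNorm K p' volume * eLpNorm u p volume := by
  refine (enorm_integral_le_lintegral_enorm _).trans ?_
  rw [← eLpNorm_comp_sub_left p' hK.aestronglyMeasurable x]
  exact lintegral_enorm_mul_le (hK.comp (continuous_const.sub continuous_id)).aestronglyMeasurable hu

theorem eLpNorm_conv_le {p : ℝ≥0∞} (hp : 1 ≤ p) {K u : Rn n → ℂ} (hK : Continuous K)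
    (hu : AEStronglyMeasurable u) :
    eLpNorm (conv K u) p volume ≤ eLpNorm K 1 volume * eLpNorm u p volume := by
  have h := eLpNorm_lintegral_sub_mul_le (μ := (volume : Measure (Rn n))) (a := fun x => ‖K x‖ₑ)
    (w := fun x => ‖u x‖ₑ) hK.enorm.measurable hu.enorm hp
  rw [← eLpNorm_one_eq_lintegral_enorm, eLpNorm_enorm] at h
  refine le_trans (eLpNorm_mono_enorm fun x => ?_) h
  rw [enorm_eq_self]
  refine (enorm_integral_le_lintegral_enorm _).trans (le_of_eq ?_)
  simp_rw [enorm_mul]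

theorem memLp_conv {p : ℝ≥0∞} (hp : 1 ≤ p) {K u : Rn n → ℂ} (hK : Continuous K)
    (hKi : Integrable K) (hu : MemLp u p volume) : MemLp (conv K u) p volume :=
  ⟨aestronglyMeasurable_conv hK hu.1, (eLpNorm_conv_le hp hK hu.1).trans_lt
    (ENNReal.mul_lt_top (memLp_one_iff_integrable.mpr hKi).2 hu.2)⟩

theorem integrable_conv_kernel {p p' : ℝ≥0∞} [p'.HolderConjugate p] {K u : Rn n → ℂ}
    (hK : Continuous K) (hKp : MemLp K p' volume) (hu : MemLp u p volume) (x : Rn n) :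
    Integrable fun y => K (x - y) * u y := by
  refine MemLp.integrable_mul (p := p') (q := p) ⟨(hK.comp (continuous_const.sub
    continuous_id)).aestronglyMeasurable, ?_⟩ hu
  exact (eLpNorm_comp_sub_left p' hKp.1 x).trans_lt hKp.2

/-- Fubini. It moves a convolution operator to the other factor of a pairing; with a test function
as a, it identifies □_k on functions. -/
theorem integral_mul_conv {p p' : ℝ≥0∞} [p'.HolderConjugate p] {a K u : Rn n → ℂ}
    (ha : MemLp a p' volume) (hK : Continuous K) (hKi : Integrable K) (hu : MemLp u p volume) :
    ∫ x, a x * conv K u x = ∫ y, (∫ x, a x * K (x - y)) * u y := by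
  have hmeas : AEStronglyMeasurable (fun z : Rn n × Rn n => a z.1 * (K (z.1 - z.2) * u z.2))
      (volume.prod volume) :=
    (ha.1.comp_quasiMeasurePreserving Measure.quasiMeasurePreserving_fst).mul
      (aestronglyMeasurable_sub_mul hK hu.1)
  have hint : Integrable (fun z : Rn n × Rn n => a z.1 * (K (z.1 - z.2) * u z.2))
      (volume.prod volume) := by
    refine ⟨hmeas, ?_⟩
    rw [hasFiniteIntegral_iff_enorm, lintegral_prod _ hmeas.enorm]
    have hmeas' : AEMeasurable (fun z : Rn n × Rn n => ‖a z.1 * (K z.2 * u (z.1 - z.2))‖ₑ)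
        (volume.prod volume) :=
      ((ha.1.comp_quasiMeasurePreserving Measure.quasiMeasurePreserving_fst).mul
        ((hK.comp continuous_snd).aestronglyMeasurable.mul
        (hu.1.comp_quasiMeasurePreserving (quasiMeasurePreserving_sub_of_right_invariant
          volume volume)))).enorm
    -- Substituting z = x - y makes the inner integral a pairing of a with a translate of u, which
    -- Hölder bounds uniformly in z; the remaining integral is the L¹ norm of K.
    calc ∫⁻ x, ∫⁻ y, ‖a x * (K (x - y) * u y)‖ₑ
        = ∫⁻ x, ∫⁻ z, ‖a x * (K z * u (x - z))‖ₑ := by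
          refine lintegral_congr fun x => ?_
          rw [← lintegral_sub_left_eq_self (fun z => ‖a x * (K z * u (x - z))‖ₑ) x]
          simp
      _ = ∫⁻ z, ∫⁻ x, ‖a x * (K z * u (x - z))‖ₑ := lintegral_lintegral_swap hmeas'
      _ ≤ ∫⁻ z, ‖K z‖ₑ * (eLpNorm a p' volume * eLpNorm u p volume) := by
          refine lintegral_mono fun z => ?_
          have e (x : Rn n) : ‖a x * (K z * u (x - z))‖ₑ = ‖K z‖ₑ * ‖a x * u (x - z)‖ₑ := by
            simp only [enorm_mul]
            ring
          simp_rw [e]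
          rw [lintegral_const_mul' _ _ enorm_ne_top, ← eLpNorm_comp_sub_right p hu.1 z]
          gcongr
          exact lintegral_enorm_mul_le ha.1 (hu.1.comp_measurePreserving
            (measurePreserving_sub_right volume z))
      _ < ⊤ := by
          rw [lintegral_mul_const' _ _ (ENNReal.mul_lt_top ha.2 hu.2).ne,
            ← eLpNorm_one_eq_lintegral_enorm]
          exact ENNReal.mul_lt_top (memLp_one_iff_integrable.mpr hKi).2
            (ENNReal.mul_lt_top ha.2 hu.2)
  have h := integral_integral_swap (f := fun x y => a x * (K (x - y) * u y)) hint
  simp_rw [conv, ← integral_const_mul, ← integral_mul_const, mul_assoc]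
  exact h

end Convolution

/-! ### Bump functions in S_s and uniqueness of representing functions. -/

section TestFunctions

variable {V F : Type*} [NormedAddCommGroup V] [NormedSpace ℝ V]
  [NormedAddCommGroup F] [NormedSpace ℝ F] {n : ℕ} {s : ℝ}

/-- For ‖x‖ ≤ R the power ‖x‖ ^ k is absorbed into the constant h; on the open set ‖x‖ > R all
derivatives vanish. -/
theorem GSBound.of_support {h A R : ℝ} {f : V → F} (hs : 0 ≤ s) (hh : 0 ≤ h) (hA : 0 ≤ A)
    (hf : ∀ m x, ‖iteratedFDeriv ℝ m f x‖ ≤ A * h ^ m * (m.factorial : ℝ) ^ s)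
    (hR : ∀ x, R < ‖x‖ → f x = 0) : GSBound s (max h R) A f := by
  intro k m x
  have hH : 0 ≤ max h R := hh.trans (le_max_left _ _)
  rcases lt_or_ge R ‖x‖ with hx | hx
  · have : f =ᶠ[nhds x] fun _ => 0 := by
      filter_upwards [(isOpen_lt continuous_const continuous_norm).mem_nhds hx] with y hy
      exact hR y hy
    rw [(this.iteratedFDeriv ℝ m).eq_of_nhds]
    simp only [iteratedFDeriv_fun_zero, Pi.zero_apply, norm_zero, mul_zero]
    positivity
  · have h1 : ‖x‖ ^ k ≤ (max h R) ^ k := by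
      gcongr
      exact hx.trans (le_max_right _ _)
    have h2 : h ^ m ≤ (max h R) ^ m := by
      gcongr
      exact le_max_left _ _
    have h3 : (m.factorial : ℝ) ^ s ≤ ((k.factorial : ℝ) * m.factorial) ^ s := by
      gcongr
      exact le_mul_of_one_le_left (by positivity) (by exact_mod_cast Nat.factorial_pos k)
    calc _ ≤ (max h R) ^ k * (A * h ^ m * (m.factorial : ℝ) ^ s) := by
          gcongr
          exact hf m x
      _ ≤ (max h R) ^ k * (A * (max h R) ^ m * ((k.factorial : ℝ) * m.factorial) ^ s) := by gcongr
      _ = _ := by rw [pow_add]; ring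

theorem norm_iteratedFDeriv_ofReal_comp {g : V → ℝ} (hg : ContDiff ℝ ∞ g) (m : ℕ) (x : V) :
    ‖iteratedFDeriv ℝ m (fun ξ => (g ξ : ℂ)) x‖ = ‖iteratedFDeriv ℝ m g x‖ :=
  Complex.ofRealLI.norm_iteratedFDeriv_comp_left hg.contDiffAt (mod_cast le_top)

theorem FrequencyDecomposition.ρ_eq_zero (d : FrequencyDecomposition n s) {ξ : Rn n}
    (hξ : (n : ℝ) + 1 ≤ ‖ξ‖) : d.ρ ξ = 0 := by
  by_contra h
  have h1 : ‖ξ‖ ≤ Real.sqrt n := by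
    rw [EuclideanSpace.norm_eq]
    apply Real.sqrt_le_sqrt
    calc _ ≤ ∑ _i : Fin n, (1 : ℝ) := Finset.sum_le_sum fun i _ =>
          pow_le_one₀ (norm_nonneg _) (d.support ξ h i)
      _ = n := by simp
  have h2 : Real.sqrt n < n + 1 := by
    rw [Real.sqrt_lt' (by positivity)]
    nlinarith [(Nat.cast_nonneg n : (0 : ℝ) ≤ n)]
  linarith

/-- The test functions `y ↦ ρ((y - x) / ε)`. -/
theorem FrequencyDecomposition.exists_testFunction (d : FrequencyDecomposition n s) (hs : 0 ≤ s)
    (x : Rn n) {ε : ℝ} (hε : 0 < ε) :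
    ∃ φ : gelfandShilov n s, ∀ y, (φ : 𝓢(Rn n, ℂ)) y = (d.ρ (ε⁻¹ • (y - x)) : ℂ) := by
  obtain ⟨h, hh, A, hA⟩ := d.gevrey
  let g : Rn n ≃L[ℝ] Rn n :=
    ContinuousLinearEquiv.smulLeft (R₁ := ℝ) (M₁ := Rn n) (Units.mk0 ε⁻¹ (inv_ne_zero hε.ne'))
  have hg : ContDiff ℝ ∞ fun y => d.ρ (ε⁻¹ • (y - x)) :=
    d.smooth.comp (by fun_prop)
  have hgc : ContDiff ℝ ∞ fun y => (d.ρ (ε⁻¹ • (y - x)) : ℂ) := Complex.ofRealCLM.contDiff.comp hg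
  have hbound := hA.comp_equiv d.smooth g
  set H := max ‖(g : Rn n →L[ℝ] Rn n)‖ ‖(g.symm : Rn n →L[ℝ] Rn n)‖ * h
  have hH : 0 ≤ H := by positivity
  have hsupp (y : Rn n) (hy : ‖x‖ + ε * (n + 1) < ‖y‖) : (d.ρ (ε⁻¹ • (y - x)) : ℂ) = 0 := by
    rw [d.ρ_eq_zero, Complex.ofReal_zero]
    rw [norm_smul, norm_inv, Real.norm_of_nonneg hε.le, inv_mul_eq_div, le_div_iff₀ hε]
    linarith [norm_sub_norm_le y x]
  have hcs : HasCompactSupport fun y => (d.ρ (ε⁻¹ • (y - x)) : ℂ) :=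
    HasCompactSupport.intro (isCompact_closedBall (0 : Rn n) (‖x‖ + ε * (n + 1))) fun y hy =>
      hsupp y (by simpa using hy)
  refine ⟨⟨hcs.toSchwartzMap hgc, max H (‖x‖ + ε * (n + 1)), lt_max_of_lt_right (by positivity), A,
    GSBound.of_support hs hH hA.nonneg (fun m y => ?_) hsupp⟩, fun y => rfl⟩
  change ‖iteratedFDeriv ℝ m (fun y => (d.ρ (ε⁻¹ • (y - x)) : ℂ)) y‖ ≤ _
  rw [norm_iteratedFDeriv_ofReal_comp hg]
  change ‖iteratedFDeriv ℝ m (fun y => (d.ρ ∘ g) (y - x)) y‖ ≤ _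
  rw [iteratedFDeriv_comp_sub]
  exact hbound.deriv_le m _

/-- The bumps ρ((· - x)/ε) lie in S_s and shrink to x, so u(x) = 0 follows at every Lebesgue point
x. -/
theorem ae_eq_zero_of_forall_integral_eq_zero (d : FrequencyDecomposition n s) (hs : 0 ≤ s)
    {u : Rn n → ℂ} (hu : LocallyIntegrable u)
    (h : ∀ φ : gelfandShilov n s, ∫ x, u x * (φ : 𝓢(Rn n, ℂ)) x = 0) : u =ᵐ[volume] 0 := by
  filter_upwards [IsUnifLocDoublingMeasure.ae_tendsto_average_norm_sub volume hu 0] with x hx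
  set r : ℝ := n + 1
  have hr : 0 < r := by positivity
  have hlim : Filter.Tendsto (fun j : ℕ => r * (1 / ((j : ℝ) + 1))) Filter.atTop
      (nhdsWithin 0 (Set.Ioi 0)) := by
    rw [tendsto_nhdsWithin_iff]
    refine ⟨?_, .of_forall fun j => by simp only [Set.mem_Ioi]; positivity⟩
    simpa using tendsto_one_div_add_atTop_nhds_zero_nat.const_mul r
  have hx' := hx (fun _ : ℕ => x) _ hlim (.of_forall fun j => by simp)
  -- The bump is supported in the ball of radius r ε and equals 1 on the ball of radius ε / 2;
  -- (2r)^n is the ratio of their volumes.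
  have key (j : ℕ) : ‖u x‖ ≤
      (2 * r) ^ n * ⨍ y in Metric.closedBall x (r * (1 / ((j : ℝ) + 1))), ‖u y - u x‖ := by
    set ε : ℝ := 1 / ((j : ℝ) + 1)
    have hε : 0 < ε := by positivity
    set B := Metric.closedBall x (r * ε)
    obtain ⟨φ, hφ⟩ := d.exists_testFunction hs x hε
    set ψ : Rn n → ℝ := fun y => d.ρ (ε⁻¹ • (y - x))
    have hψc : Continuous ψ :=
      d.smooth.continuous.comp (by fun_prop)
    have hψB (y : Rn n) (hy : y ∉ B) : ψ y = 0 := by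
      apply d.ρ_eq_zero
      rw [norm_smul, norm_inv, Real.norm_of_nonneg hε.le, inv_mul_eq_div, le_div_iff₀ hε]
      rw [Metric.mem_closedBall, dist_eq_norm, not_le] at hy
      exact hy.le
    have hψs : HasCompactSupport ψ := HasCompactSupport.intro (isCompact_closedBall _ _) hψB
    have hψi : Integrable ψ := hψc.integrable_of_hasCompactSupport hψs
    have hui : Integrable fun y => u y * ψ y := by
      have := hu.integrable_smul_left_of_hasCompactSupport hψc hψs
      refine this.congr (.of_forall fun y => ?_)
      simp [mul_comm]
    have h0 : ∫ y, u y * ψ y = 0 := by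
      rw [← h φ]
      simp_rw [hφ, ψ]
    have hBfin : volume B ≠ ⊤ := measure_closedBall_lt_top.ne
    have huB : IntegrableOn (fun y => ‖u y - u x‖) B :=
      ((hu.integrableOn_isCompact (isCompact_closedBall _ _)).sub (integrableOn_const hBfin)).norm
    -- lower bound for the mass of the test function
    have hmass : volume.real (Metric.closedBall x (ε / 2)) ≤ ∫ y, ψ y := by
      have e : volume.real (Metric.closedBall x (ε / 2)) =
          ∫ y, (Metric.closedBall x (ε / 2)).indicator (fun _ => (1 : ℝ)) y := by
        rw [integral_indicator measurableSet_closedBall]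
        simp [measureReal_def]
      rw [e]
      refine integral_mono ((integrable_indicator_iff measurableSet_closedBall).mpr
        (integrableOn_const measure_closedBall_lt_top.ne)) hψi fun y => ?_
      by_cases hy : y ∈ Metric.closedBall x (ε / 2)
      · rw [Set.indicator_of_mem hy]
        refine (d.eq_one _ ?_).ge
        rw [norm_smul, norm_inv, Real.norm_of_nonneg hε.le, inv_mul_eq_div, div_le_iff₀ hε,
          ← dist_eq_norm]
        rw [Metric.mem_closedBall] at hy
        linarith
      · rw [Set.indicator_of_notMem hy]
        exact d.nonneg _
    -- Since u is orthogonal to ψ, the quantity u(x) ∫ ψ equals ∫ (u(x) - u(y)) ψ(y) dy, and 0 ≤ ψ ≤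
    -- 1 with ψ supported in B.
    have hupper : ‖u x‖ * ∫ y, ψ y ≤ ∫ y in B, ‖u y - u x‖ := by
      have e1 : u x * ((∫ y, ψ y : ℝ) : ℂ) = ∫ y, (u x - u y) * ψ y := by
        have hψC : Integrable fun y => (ψ y : ℂ) := hψi.ofReal
        simp_rw [sub_mul]
        rw [integral_sub (hψC.const_mul _) hui, h0, sub_zero, integral_const_mul,
          integral_complex_ofReal]
      have e2 : ‖u x‖ * ∫ y, ψ y = ‖∫ y, (u x - u y) * ψ y‖ := by
        rw [← e1, norm_mul, Complex.norm_real,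
          Real.norm_of_nonneg (integral_nonneg fun y => d.nonneg _)]
      rw [e2, ← setIntegral_eq_integral_of_forall_compl_eq_zero (s := B)
        fun y hy => by rw [hψB y hy]; simp]
      refine norm_integral_le_of_norm_le huB (.of_forall fun y => ?_)
      rw [norm_mul, norm_sub_rev, Complex.norm_real, Real.norm_of_nonneg (d.nonneg _)]
      exact mul_le_of_le_one_right (norm_nonneg _) (d.le_one _)
    have hvol : volume.real B = (2 * r) ^ n * volume.real (Metric.closedBall x (ε / 2)) := by
      rw [Measure.addHaar_real_closedBall _ _ (by positivity),
        Measure.addHaar_real_closedBall _ _ (by positivity), finrank_euclideanSpace_fin,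
        ← mul_assoc, ← mul_pow]
      congr 2
      ring
    have hpos : 0 < volume.real (Metric.closedBall x (ε / 2)) := by
      rw [measureReal_def, ENNReal.toReal_pos_iff]
      exact ⟨Metric.measure_closedBall_pos _ _ (by positivity), measure_closedBall_lt_top⟩
    rw [setAverage_eq, smul_eq_mul, hvol, mul_inv, ← mul_assoc, ← mul_assoc,
      mul_inv_cancel₀ (by positivity), one_mul, inv_mul_eq_div, le_div_iff₀ hpos]
    refine le_trans ?_ hupper
    gcongr
  have hlim0 := hx'.const_mul ((2 * r) ^ n)
  rw [mul_zero] at hlim0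
  have := ge_of_tendsto' hlim0 key
  simpa using norm_le_zero_iff.mp this

/-- The exponents may differ. This makes `lpNorm` the norm of any representative in L^p, and makes
the product independent of the chosen functions. -/
theorem Represents.ae_eq (d : FrequencyDecomposition n s) (hs : 0 ≤ s) {u v : Rn n → ℂ}
    {f : gelfandShilovDual n s} {p q : ℝ≥0∞} (hp : 1 ≤ p) (hq : 1 ≤ q)
    (hu : MemLp u p volume) (hv : MemLp v q volume)
    (hfu : Represents u f) (hfv : Represents v f) : u =ᵐ[volume] v := by
  have int {w : Rn n → ℂ} {p : ℝ≥0∞} (hp : 1 ≤ p) (hw : MemLp w p volume)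
      (φ : gelfandShilov n s) : Integrable fun x => w x * (φ : 𝓢(Rn n, ℂ)) x := by
    have : p.HolderConjugate (ENNReal.conjExponent p) := ENNReal.HolderConjugate.conjExponent hp
    exact MemLp.integrable_mul (p := p) (q := ENNReal.conjExponent p) hw (SchwartzMap.memLp _ _ _)
  have := ae_eq_zero_of_forall_integral_eq_zero d hs (u := u - v)
    ((hu.locallyIntegrable hp).sub (hv.locallyIntegrable hq)) fun φ => by
      simp_rw [Pi.sub_apply, sub_mul]
      rw [integral_sub (int hp hu φ) (int hq hv φ), ← hfu φ, ← hfv φ, sub_self]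
  filter_upwards [this] with x hx
  simpa [sub_eq_zero] using hx

end TestFunctions

end GevreyModulation
namespace GevreyModulation

/-! ### Fourier inversion and convolution kernels of Fourier multipliers. -/

section Fourier

variable {n : ℕ}

/-- The normalizing constant `(2π)^{-n/2}`. -/
noncomputable def fourierConst (n : ℕ) : ℂ := (((2 * Real.pi) ^ (-(n : ℝ) / 2) : ℝ) : ℂ)

theorem fourierConst_ne_zero (n : ℕ) : fourierConst n ≠ 0 := by
  rw [fourierConst, Complex.ofReal_ne_zero]
  positivity

theorem fourierConst_mul_self (n : ℕ) :
    fourierConst n * fourierConst n = ((((2 * Real.pi) ^ n)⁻¹ : ℝ) : ℂ) := by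
  rw [fourierConst, ← Complex.ofReal_mul, ← Real.rpow_add (by positivity), ← Real.rpow_natCast,
    ← Real.rpow_neg (by positivity)]
  congr 2
  ring

/-- The two transforms differ only in the sign of c, so one statement covers both orders of
inversion. The Jacobian |c|^{-n} = (2π)^n of the dilation cancels the square of the normalizing
constant. -/
theorem scaledFourier_neg_comp (c : ℝ) (hc : c ≠ 0) (hc' : -c ≠ 0) (h : |c| = (2 * Real.pi)⁻¹)
    (φ : 𝓢(Rn n, ℂ)) : scaledFourier n c hc (scaledFourier n (-c) hc' φ) = φ := by
  ext ξ
  rw [scaledFourier_apply]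
  have e1 (x : Rn n) : scaledFourier n (-c) hc' φ x = fourierConst n * 𝓕 (φ : Rn n → ℂ) ((-c) • x) :=
    rfl
  let G : Rn n → ℂ := fun y => fourierConst n *
    (Complex.exp (((2 * Real.pi * inner ℝ y ξ : ℝ) : ℂ) * Complex.I) • (𝓕 φ : 𝓢(Rn n, ℂ)) y)
  have e2 (x : Rn n) : Complex.exp (((-2 * Real.pi * c * inner ℝ x ξ : ℝ) : ℂ) * Complex.I) *
      scaledFourier n (-c) hc' φ x = G ((-c) • x) := by
    simp only [G]
    rw [e1, smul_eq_mul, SchwartzMap.fourier_coe]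
    simp only [inner_smul_left, RCLike.conj_to_real]
    rw [show 2 * Real.pi * (-c * inner ℝ x ξ) = -2 * Real.pi * c * inner ℝ x ξ by ring]
    ring
  simp_rw [e2]
  rw [Measure.integral_comp_smul volume G, integral_const_mul, ← Real.fourierInv_eq',
    ← SchwartzMap.fourierInv_coe, FourierTransform.fourierInv_fourier_eq, finrank_euclideanSpace_fin,
    abs_inv, abs_pow, abs_neg, h, inv_pow, inv_inv, Complex.real_smul]
  change fourierConst n * _ = _
  rw [mul_left_comm, ← mul_assoc (fourierConst n), fourierConst_mul_self, ← mul_assoc,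
    ← Complex.ofReal_mul, mul_inv_cancel₀ (by positivity), Complex.ofReal_one, one_mul]

theorem fourierT_fourierTInv (φ : 𝓢(Rn n, ℂ)) : fourierT n (fourierTInv n φ) = φ :=
  scaledFourier_neg_comp _ _ _ (abs_of_pos (by positivity)) φ

theorem fourierTInv_fourierT (φ : 𝓢(Rn n, ℂ)) : fourierTInv n (fourierT n φ) = φ := by
  have h := scaledFourier_neg_comp (n := n) (-(2 * Real.pi)⁻¹) (neg_ne_zero.mpr (by positivity))
    (by rw [neg_neg]; positivity) (by rw [abs_neg]; exact abs_of_pos (by positivity)) φ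
  simp only [neg_neg] at h
  exact h

/-- The convolution kernel of the Fourier multiplier `m`. -/
noncomputable def multiplierKernel (m : 𝓢(Rn n, ℂ)) : 𝓢(Rn n, ℂ) := fourierConst n • fourierTInv n m

theorem multiplierKernel_apply (m : 𝓢(Rn n, ℂ)) (x : Rn n) :
    multiplierKernel m x = fourierConst n * (fourierConst n *
      ∫ ξ, Complex.exp (Complex.I * (inner ℝ ξ x : ℝ)) * m ξ) := by
  rw [multiplierKernel, _root_.smul_apply, fourierTInv_apply]
  rfl

theorem norm_exp_I_mul_ofReal (t : ℝ) : ‖Complex.exp (Complex.I * (t : ℂ))‖ = 1 := by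
  rw [mul_comm, Complex.norm_exp_ofReal_mul_I]

/-- Inserting the integral for the kernel and exchanging the integrals shows that pairing with
translates of the kernel is 𝓕(m 𝓕⁻¹g). Only integrability of g is asked, so that g may itself be a
product of kernels and plane waves. -/
theorem integral_mul_multiplierKernel {g : Rn n → ℂ} (hg : Integrable g) (m : 𝓢(Rn n, ℂ))
    (z : Rn n) : ∫ t, g t * multiplierKernel m (t - z) =
      fourierConst n * ∫ ζ, Complex.exp (-(Complex.I * (inner ℝ ζ z : ℝ))) *
        (m ζ * (fourierConst n * ∫ t, Complex.exp (Complex.I * (inner ℝ t ζ : ℝ)) * g t)) := by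
  have hint : Integrable (fun w : Rn n × Rn n => Complex.exp (Complex.I * (inner ℝ w.2 (w.1 - z) : ℝ)) *
      (g w.1 * m w.2)) (volume.prod volume) := by
    refine (hg.mul_prod m.integrable).bdd_mul (c := 1) ?_ (.of_forall fun w => ?_)
    · exact (by fun_prop : Continuous fun w : Rn n × Rn n =>
        Complex.exp (Complex.I * (inner ℝ w.2 (w.1 - z) : ℝ))).aestronglyMeasurable
    · rw [norm_exp_I_mul_ofReal]
  have hswap := integral_integral_swap (f := fun t ζ =>
    Complex.exp (Complex.I * (inner ℝ ζ (t - z) : ℝ)) * (g t * m ζ)) hint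
  simp_rw [multiplierKernel_apply]
  calc _ = fourierConst n * (fourierConst n * ∫ t, ∫ ζ,
        Complex.exp (Complex.I * (inner ℝ ζ (t - z) : ℝ)) * (g t * m ζ)) := by
        rw [← integral_const_mul, ← integral_const_mul]
        refine integral_congr_ae (.of_forall fun t => ?_)
        simp only
        have : ∫ ζ, Complex.exp (Complex.I * (inner ℝ ζ (t - z) : ℝ)) * (g t * m ζ) =
            g t * ∫ ζ, Complex.exp (Complex.I * (inner ℝ ζ (t - z) : ℝ)) * m ζ := by
          rw [← integral_const_mul]
          refine integral_congr_ae (.of_forall fun ζ => ?_)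
          simp only
          ring
        rw [this]
        ring
    _ = _ := by
        rw [hswap]
        congr 1
        rw [← integral_const_mul]
        refine integral_congr_ae (.of_forall fun ζ => ?_)
        simp only
        have : ∫ t, Complex.exp (Complex.I * (inner ℝ ζ (t - z) : ℝ)) * (g t * m ζ) =
            Complex.exp (-(Complex.I * (inner ℝ ζ z : ℝ))) * m ζ *
              ∫ t, Complex.exp (Complex.I * (inner ℝ t ζ : ℝ)) * g t := by
          rw [← integral_const_mul]
          refine integral_congr_ae (.of_forall fun t => ?_)
          simp only
          rw [inner_sub_right, real_inner_comm t ζ, Complex.ofReal_sub, mul_sub, sub_eq_add_neg,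
            Complex.exp_add]
          ring
        rw [this]
        ring

theorem fourierT_mul_fourierTInv {m φ ψ : 𝓢(Rn n, ℂ)} (h : ∀ ξ, ψ ξ = m ξ * fourierTInv n φ ξ)
    (y : Rn n) : fourierT n ψ y = ∫ x, φ x * multiplierKernel m (x - y) := by
  rw [integral_mul_multiplierKernel φ.integrable, fourierT_apply]
  congr 1
  refine integral_congr_ae (.of_forall fun ζ => ?_)
  simp only
  rw [h, fourierTInv_apply]
  rfl

/-- Plane waves are eigenfunctions of convolution with the kernel, and the eigenvalue is the value
of the multiplier at their frequency. -/
theorem integral_exp_mul_multiplierKernel (m : 𝓢(Rn n, ℂ)) (x w : Rn n) :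
    ∫ t, Complex.exp (Complex.I * (inner ℝ t w : ℝ)) * multiplierKernel m (x - t) =
      Complex.exp (Complex.I * (inner ℝ x w : ℝ)) * m w := by
  have h1 : fourierT n (multiplierKernel m) w = fourierConst n * m w := by
    rw [multiplierKernel, map_smul, fourierT_fourierTInv, _root_.smul_apply, smul_eq_mul]
  rw [fourierT_apply] at h1
  have h2 := mul_left_cancel₀ (fourierConst_ne_zero n) h1
  rw [← h2, ← integral_const_mul,
    ← integral_sub_left_eq_self (fun t => Complex.exp (Complex.I * (inner ℝ x w : ℝ)) *
      (Complex.exp (-(Complex.I * (inner ℝ t w : ℝ))) * multiplierKernel m t)) volume x]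
  refine integral_congr_ae (.of_forall fun t => ?_)
  simp only
  rw [← mul_assoc, ← Complex.exp_add, inner_sub_left]
  congr 2
  push_cast
  ring

/-- The frequencies of a product lie in the sum of the sets of frequencies. -/
theorem integral_multiplierKernel_mul_mul_eq_zero {m₀ m₁ m₂ : 𝓢(Rn n, ℂ)}
    (h : ∀ η ζ, m₁ η * m₂ ζ * m₀ (η + ζ) = 0) (x y z : Rn n) :
    ∫ t, multiplierKernel m₀ (x - t) * multiplierKernel m₁ (t - y) * multiplierKernel m₂ (t - z) = 0 := by
  have hint0 : Integrable fun t => multiplierKernel m₀ (x - t) :=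
    (multiplierKernel m₀).integrable.comp_sub_left x
  obtain ⟨C, hC⟩ := (multiplierKernel m₁).decay 0 0
  have hint1 : Integrable fun t => multiplierKernel m₀ (x - t) * multiplierKernel m₁ (t - y) := by
    refine hint0.mul_bdd (c := C)
      ((multiplierKernel m₁).continuous.comp (by fun_prop)).aestronglyMeasurable
      (.of_forall fun t => ?_)
    simpa using hC.2 (t - y)
  rw [integral_mul_multiplierKernel hint1]
  -- The kernel formula is used a second time, now for m₁. The two plane waves merge into one of
  -- frequency η + ζ, which the m₀ kernel multiplies by m₀(η + ζ), so the hypothesis annihilates the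
  -- integrand.
  have key (ζ : Rn n) : m₂ ζ * ∫ t, Complex.exp (Complex.I * (inner ℝ t ζ : ℝ)) *
      (multiplierKernel m₀ (x - t) * multiplierKernel m₁ (t - y)) = 0 := by
    simp_rw [← mul_assoc (Complex.exp _)]
    rw [integral_mul_multiplierKernel]
    · rw [mul_left_comm, ← integral_const_mul]
      refine mul_eq_zero_of_right _ (integral_eq_zero_of_ae (.of_forall fun η => ?_))
      have e (t : Rn n) : Complex.exp (Complex.I * (inner ℝ t η : ℝ)) *
          (Complex.exp (Complex.I * (inner ℝ t ζ : ℝ)) * multiplierKernel m₀ (x - t)) =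
          Complex.exp (Complex.I * (inner ℝ t (η + ζ) : ℝ)) * multiplierKernel m₀ (x - t) := by
        rw [← mul_assoc, ← Complex.exp_add, inner_add_right]
        push_cast
        rw [mul_add]
      simp_rw [e]
      rw [integral_exp_mul_multiplierKernel]
      simp only [Pi.zero_apply]
      linear_combination (Complex.exp (-(Complex.I * (inner ℝ η y : ℝ))) * fourierConst n *
        Complex.exp (Complex.I * (inner ℝ x (η + ζ) : ℝ))) * h η ζ
    · refine hint0.bdd_mul (c := 1) (by fun_prop : Continuous fun t : Rn n =>
        Complex.exp (Complex.I * (inner ℝ t ζ : ℝ))).aestronglyMeasurable (.of_forall fun t => ?_)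
      rw [norm_exp_I_mul_ofReal]
  refine mul_eq_zero_of_right _ (integral_eq_zero_of_ae (.of_forall fun ζ => ?_))
  simp only [Pi.zero_apply]
  rw [mul_left_comm (m₂ ζ), key, mul_zero, mul_zero]

end Fourier

/-! ### The kernels of □_k: uniform norms, interactions and the reproducing identity. -/

namespace FrequencyDecomposition

variable {n : ℕ} {s : ℝ} (d : FrequencyDecomposition n s)

theorem abs_sub_le_of_σ_ne_zero {k : Fin n → ℤ} {ξ : Rn n} (h : d.σ k ξ ≠ 0) (i : Fin n) :
    |ξ i - k i| ≤ 1 :=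
  d.support (ξ - latticePoint k) (fun h0 => h (by rw [σ, h0, zero_div])) i

theorem σ_eq_σ_zero (k : Fin n → ℤ) (ξ : Rn n) : d.σ k ξ = d.σ 0 (ξ - latticePoint k) := by
  have h0 : latticePoint (0 : Fin n → ℤ) = 0 := by ext i; simp [latticePoint]
  have h1 := d.sum_add_latticePoint k (ξ - latticePoint k)
  rw [sub_add_cancel] at h1
  rw [σ, σ, h0, sub_zero, h1]

theorem hasCompactSupport_σ (k : Fin n → ℤ) : HasCompactSupport fun ξ => (d.σ k ξ : ℂ) := by
  refine HasCompactSupport.intro (isCompact_closedBall (latticePoint k) (n + 1)) fun ξ hξ => ?_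
  rw [Metric.mem_closedBall, dist_eq_norm, not_le] at hξ
  rw [σ, d.ρ_eq_zero hξ.le, zero_div, Complex.ofReal_zero]

/-- `σ_k` as a Schwartz function. -/
noncomputable def σSchwartz (k : Fin n → ℤ) : 𝓢(Rn n, ℂ) :=
  (d.hasCompactSupport_σ k).toSchwartzMap (d.smooth_ofReal_σ k)

theorem σSchwartz_apply (k : Fin n → ℤ) (ξ : Rn n) : d.σSchwartz k ξ = d.σ k ξ := rfl

/-- The convolution kernel of `□_k`. -/
noncomputable def kernel (k : Fin n → ℤ) : 𝓢(Rn n, ℂ) := multiplierKernel (d.σSchwartz k)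

/-- σ_k is the translate of σ_0 by k, so its kernel is that of σ_0 times a unimodular character. -/
theorem norm_kernel (k : Fin n → ℤ) (x : Rn n) : ‖d.kernel k x‖ = ‖d.kernel 0 x‖ := by
  have h : d.kernel k x = Complex.exp (Complex.I * (inner ℝ (latticePoint k) x : ℝ)) * d.kernel 0 x := by
    rw [kernel, kernel, multiplierKernel_apply, multiplierKernel_apply]
    have e : ∫ ξ, Complex.exp (Complex.I * (inner ℝ ξ x : ℝ)) * d.σSchwartz k ξ =
        Complex.exp (Complex.I * (inner ℝ (latticePoint k) x : ℝ)) *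
          ∫ ξ, Complex.exp (Complex.I * (inner ℝ ξ x : ℝ)) * d.σSchwartz 0 ξ := by
      rw [← integral_const_mul, ← integral_sub_right_eq_self (fun ξ =>
        Complex.exp (Complex.I * (inner ℝ (latticePoint k) x : ℝ)) *
          (Complex.exp (Complex.I * (inner ℝ ξ x : ℝ)) * d.σSchwartz 0 ξ)) (latticePoint k)]
      refine integral_congr_ae (.of_forall fun ξ => ?_)
      simp only
      rw [← mul_assoc, ← Complex.exp_add, σSchwartz_apply, σSchwartz_apply, d.σ_eq_σ_zero k,
        inner_sub_left]
      congr 2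
      push_cast
      ring
    rw [e]
    ring
  rw [h, norm_mul, norm_exp_I_mul_ofReal, one_mul]

theorem eLpNorm_kernel (k : Fin n → ℤ) (p : ℝ≥0∞) :
    eLpNorm (d.kernel k) p volume = eLpNorm (d.kernel 0) p volume :=
  eLpNorm_congr_norm_ae (.of_forall fun x => d.norm_kernel k x)

/-- The operator `𝓕 σ_k 𝓕⁻¹` on test functions. -/
noncomputable def boxTest (k : Fin n → ℤ) : 𝓢(Rn n, ℂ) →ₗ[ℂ] 𝓢(Rn n, ℂ) :=
  fourierT n ∘ₗ d.mulσ k ∘ₗ fourierTInv n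

theorem boxTest_apply (hs : 1 ≤ s) (k : Fin n → ℤ) (φ : 𝓢(Rn n, ℂ)) (y : Rn n) :
    d.boxTest k φ y = ∫ x, φ x * d.kernel k (x - y) :=
  fourierT_mul_fourierTInv (fun ξ => d.mulσ_apply hs k (fourierTInv n φ) ξ) y

theorem boxTest_mem (hs : 1 ≤ s) (k : Fin n → ℤ) {φ : 𝓢(Rn n, ℂ)} (hφ : φ ∈ gelfandShilov n s) :
    d.boxTest k φ ∈ gelfandShilov n s :=
  (scaledFourier_isGSBounded n _ _ hs).mem _ ((d.mulσ_isGSBounded hs k).mem _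
    ((scaledFourier_isGSBounded n _ _ hs).mem _ hφ))

/-- In each coordinate the supports of σ_l, σ_m, σ_k reach at most 1 from l, m, k. If η, ζ and η + ζ
lie in them, then k - l - m is off by at most 1 + 1 + 1. -/
theorem kernel_mul_mul_eq_zero {k l m : Fin n → ℤ} {i : Fin n} (h : 3 < |k i - l i - m i|)
    (x y z : Rn n) :
    ∫ t, d.kernel k (x - t) * d.kernel l (t - y) * d.kernel m (t - z) = 0 := by
  refine integral_multiplierKernel_mul_mul_eq_zero (fun η ζ => ?_) x y z
  simp only [σSchwartz_apply]
  by_contra hne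
  simp only [mul_eq_zero, Complex.ofReal_eq_zero, not_or] at hne
  have h1 := abs_le.mp (d.abs_sub_le_of_σ_ne_zero hne.1.1 i)
  have h2 := abs_le.mp (d.abs_sub_le_of_σ_ne_zero hne.1.2 i)
  have h3 := abs_le.mp (d.abs_sub_le_of_σ_ne_zero hne.2 i)
  have h4 : |((k i - l i - m i : ℤ) : ℝ)| ≤ 3 := by
    push_cast
    rw [PiLp.add_apply] at h3
    rw [abs_le]
    constructor <;> linarith
  have h5 : |k i - l i - m i| ≤ 3 := by exact_mod_cast h4
  omega

/-- The indices `r` with `|r|_∞ ≤ N`. -/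
noncomputable def cube (n : ℕ) (N : ℕ) : Finset (Fin n → ℤ) := Fintype.piFinset fun _ => Finset.Icc (-(N : ℤ)) N

/-- Two supports of coordinate radius 1 can meet only if their centres differ by at most 2 in each
coordinate, so the neighbours in the cube already exhaust the partition of unity on the support of
σ_l. -/
theorem sum_cube_σ {l : Fin n → ℤ} {ξ : Rn n} (h : d.σ l ξ ≠ 0) :
    ∑ r ∈ cube n 2, d.σ (l + r) ξ = 1 := by
  have h1 : d.sum ξ = ∑ r ∈ cube n 2, d.ρ (ξ - latticePoint (l + r)) := by
    rw [FrequencyDecomposition.sum, ← (Equiv.addLeft l).tsum_eq]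
    refine tsum_eq_sum fun r hr => ?_
    by_contra hne
    apply hr
    rw [cube, Fintype.mem_piFinset]
    intro i
    have h2 := abs_le.mp (d.abs_sub_le_of_σ_ne_zero h i)
    have h3 : |ξ i - ((l i + r i : ℤ) : ℝ)| ≤ 1 := d.support _ hne i
    push_cast at h3
    have h4 : |(r i : ℝ)| ≤ 2 := by
      have h3 := abs_le.mp h3
      rw [abs_le]
      constructor <;> linarith
    have h5 : |r i| ≤ 2 := by exact_mod_cast h4
    rw [Finset.mem_Icc]
    exact abs_le.mp h5
  simp only [σ]
  rw [← Finset.sum_div, ← h1, div_self (d.sum_pos ξ).ne']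

theorem boxTest_sum_cube (hs : 1 ≤ s) (l : Fin n → ℤ) (φ : 𝓢(Rn n, ℂ)) :
    d.boxTest l (∑ r ∈ cube n 2, d.boxTest (l + r) φ) = d.boxTest l φ := by
  simp only [boxTest, LinearMap.comp_apply, map_sum, fourierTInv_fourierT]
  rw [← map_sum]
  congr 1
  ext ξ
  rw [_root_.sum_apply]
  simp only [d.mulσ_apply hs]
  by_cases h : d.σ l ξ = 0
  · simp [h]
  · rw [← Finset.mul_sum, ← Finset.sum_mul, ← Complex.ofReal_sum, d.sum_cube_σ h,
      Complex.ofReal_one, one_mul]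

/-! ### Convergence of the decomposition on test functions -/

theorem σ_eq_zero_of_notMem_window {x y : Rn n} (hxy : ‖y - x‖ < 1) {j : Fin n → ℤ}
    (hj : j ∉ window x) : d.σ j y = 0 := by
  rw [σ, d.eq_zero_of_notMem hxy hj, zero_div]

theorem one_sub_sum_σ_eventuallyEq (S : Finset (Fin n → ℤ)) (x : Rn n) :
    (fun y => 1 - ∑ l ∈ S, d.σ l y) =ᶠ[nhds x] fun y => ∑ l ∈ window x \ S, d.σ l y := by
  filter_upwards [Metric.ball_mem_nhds x one_pos] with y hy
  have hy : ‖y - x‖ < 1 := by rwa [← dist_eq_norm]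
  have h1 : ∑ l ∈ window x, d.σ l y = 1 := by
    simp only [σ]
    rw [← Finset.sum_div, ← d.sum_eq hy, div_self (d.sum_pos y).ne']
  have h2 : ∑ l ∈ S, d.σ l y = ∑ l ∈ window x ∩ S, d.σ l y := by
    refine (Finset.sum_subset Finset.inter_subset_right fun l hl hl' => ?_).symm
    exact d.σ_eq_zero_of_notMem_window hy fun h => hl' (Finset.mem_inter.mpr ⟨h, hl⟩)
  rw [h2, ← h1, sub_eq_iff_eq_add, add_comm, Finset.sum_inter_add_sum_sdiff]

/-- The uniformity in S is the point: near each x the function is a sum of at most 7^n of the σ_l,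
namely those of the window that are missing from S. -/
theorem exists_one_sub_sum_σ_bound (hs : 1 ≤ s) : ∃ H ≥ 1, ∃ B ≥ 0,
    ∀ (S : Finset (Fin n → ℤ)) (m : ℕ) (x : Rn n),
      ‖iteratedFDeriv ℝ m (fun y => 1 - ∑ l ∈ S, d.σ l y) x‖ ≤ B * H ^ m * (m.factorial : ℝ) ^ s := by
  obtain ⟨H, hH, B, hB, hσ⟩ := d.σ_bound hs
  refine ⟨H, hH, 7 ^ n * B, by positivity, fun S m x => ?_⟩
  rw [((d.one_sub_sum_σ_eventuallyEq S x).iteratedFDeriv ℝ m).eq_of_nhds,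
    iteratedFDeriv_fun_sum_apply fun j _ => ((d.smooth_σ j).of_le (mod_cast le_top)).contDiffAt]
  refine (norm_sum_le _ _).trans ((Finset.sum_le_sum fun j _ => hσ j m x).trans ?_)
  rw [Finset.sum_const, nsmul_eq_mul, ← mul_assoc, ← mul_assoc]
  gcongr
  have : ((window x \ S).card : ℝ) ≤ (window x).card :=
    Nat.cast_le.mpr (Finset.card_le_card Finset.sdiff_subset)
  rw [card_window] at this
  exact_mod_cast this

/-- The remainder vanishes on ‖x‖ < R because S contains every index active there. Outside, one
spare power of ‖x‖ is worth a factor 1 / R. -/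
theorem exists_remainder_bound (hs : 1 ≤ s) {h : ℝ} (hh : 0 < h) : ∃ h' > 0, ∃ K ≥ 0,
    ∀ (A : ℝ) (φ : 𝓢(Rn n, ℂ)), GSBound s h A φ → ∀ (R : ℝ), 0 < R → ∀ S : Finset (Fin n → ℤ),
      (∀ x : Rn n, ‖x‖ < R → window x ⊆ S) →
        GSBound s h' (K * A / R) (φ - ∑ l ∈ S, d.mulσ l φ) := by
  obtain ⟨H, hH, B, hB, hχ⟩ := d.exists_one_sub_sum_σ_bound hs
  set L := 2 * max H h
  have hL : 0 < L := by positivity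
  have h2s : 1 ≤ (2 : ℝ) ^ s := Real.one_le_rpow one_le_two (by linarith)
  refine ⟨2 ^ s * L, by positivity, B * L, by positivity, fun A φ hφ R hR S hS => ?_⟩
  have hA := hφ.nonneg
  have hsm : ContDiff ℝ ∞ fun y => 1 - ∑ l ∈ S, d.σ l y :=
    contDiff_const.sub (ContDiff.sum fun l _ => d.smooth_σ l)
  have hfun : ⇑(φ - ∑ l ∈ S, d.mulσ l φ) = fun x => ((1 - ∑ l ∈ S, d.σ l x : ℝ) : ℂ) • φ x := by
    funext x
    rw [_root_.sub_apply, _root_.sum_apply, smul_eq_mul]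
    simp only [d.mulσ_apply hs]
    push_cast
    rw [sub_mul, one_mul, Finset.sum_mul]
  have hb := hφ.smul_left (H := max H h) (by linarith) hh.le (hH.trans (le_max_left _ _))
    (le_max_right _ _) (φ.smooth ⊤) (Complex.ofRealCLM.contDiff.comp hsm) hB fun m x => by
      change ‖iteratedFDeriv ℝ m (fun y => ((1 - ∑ l ∈ S, d.σ l y : ℝ) : ℂ)) x‖ ≤ _
      rw [norm_iteratedFDeriv_ofReal_comp hsm]
      refine (hχ S m x).trans ?_
      gcongr
      exact le_max_left _ _
  rw [hfun]
  intro k m x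
  rcases lt_or_ge ‖x‖ R with hx | hx
  · have hz : (fun x => ((1 - ∑ l ∈ S, d.σ l x : ℝ) : ℂ) • φ x) =ᶠ[nhds x] fun _ => 0 := by
      filter_upwards [d.one_sub_sum_σ_eventuallyEq S x] with y hy
      rw [hy, Finset.sdiff_eq_empty_iff_subset.mpr (hS x hx)]
      simp
    rw [(hz.iteratedFDeriv ℝ m).eq_of_nhds]
    simp only [iteratedFDeriv_fun_zero, Pi.zero_apply, norm_zero, mul_zero]
    positivity
  -- The estimate is taken at k + 1 and divided by R ≤ ‖x‖. The extra factor k + 1 ≤ 2^{k+m} in the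
  -- factorial is what enlarges h' by 2^s.
  · have hk := hb (k + 1) m x
    change ‖x‖ ^ (k + 1) * ‖iteratedFDeriv ℝ m (fun x => ((1 - ∑ l ∈ S, d.σ l x : ℝ) : ℂ) • φ x) x‖ ≤
      B * A * L ^ (k + 1 + m) * _ at hk
    set D := ‖iteratedFDeriv ℝ m (fun x => ((1 - ∑ l ∈ S, d.σ l x : ℝ) : ℂ) • φ x) x‖
    have hD : 0 ≤ D := norm_nonneg _
    have hfac : ((((k + 1).factorial : ℕ) : ℝ) * m.factorial) ^ s ≤
        (2 ^ s) ^ (k + m) * ((k.factorial : ℝ) * m.factorial) ^ s := by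
      rw [← Real.rpow_natCast, ← Real.rpow_mul two_pos.le, mul_comm s, Real.rpow_mul two_pos.le,
        Real.rpow_natCast, ← Real.mul_rpow (by positivity) (by positivity)]
      refine Real.rpow_le_rpow (by positivity) ?_ (by linarith)
      rw [Nat.factorial_succ, Nat.cast_mul, mul_assoc]
      gcongr
      have : k + 1 ≤ 2 ^ (k + m) :=
        (Nat.lt_two_pow_self (n := k)).trans_le (Nat.pow_le_pow_right two_pos (Nat.le_add_right _ _))
      exact_mod_cast this
    have h1 : R * (‖x‖ ^ k * D) ≤ ‖x‖ ^ (k + 1) * D := by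
      rw [pow_succ', mul_assoc]
      gcongr
    have h2 : R * (‖x‖ ^ k * D) ≤ B * A * L ^ (k + 1 + m) *
        ((2 ^ s) ^ (k + m) * ((k.factorial : ℝ) * m.factorial) ^ s) :=
      h1.trans (hk.trans (by gcongr))
    calc ‖x‖ ^ k * D ≤ (B * A * L ^ (k + 1 + m) *
        ((2 ^ s) ^ (k + m) * ((k.factorial : ℝ) * m.factorial) ^ s)) / R := by
          rw [le_div_iff₀ hR]
          linarith
      _ = _ := by
          rw [mul_pow, show k + 1 + m = k + m + 1 by ring, pow_succ]
          ring

theorem window_subset_cube {N : ℕ} {x : Rn n} (hx : ‖x‖ < N) : window x ⊆ cube n (N + 4) := by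
  intro j hj
  rw [window, Fintype.mem_piFinset] at hj
  rw [cube, Fintype.mem_piFinset]
  intro i
  have h1 := Finset.mem_Icc.mp (hj i)
  have h2 := abs_lt.mp ((PiLp.norm_apply_le x i).trans_lt hx)
  have h3 : -(N : ℤ) ≤ ⌊x i⌋ := Int.le_floor.mpr (by push_cast; exact h2.1.le)
  have h4 : ⌊x i⌋ < (N : ℤ) := Int.floor_lt.mpr (by push_cast; exact h2.2)
  rw [Finset.mem_Icc]
  push_cast
  constructor <;> omega

/-- The partial sums of Σ σ_l φ converge to φ in a single space S_{s,h'}, with error O(1/N) once S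
contains a large cube, and g is bounded there. -/
theorem tendsto_sum_mulσ (hs : 1 ≤ s) (g : gelfandShilovDual n s) (φ : gelfandShilov n s) :
    Filter.Tendsto (fun S : Finset (Fin n → ℤ) => ∑ l ∈ S, (g : gelfandShilov n s →ₗ[ℂ] ℂ)
      ⟨d.mulσ l φ, (d.mulσ_isGSBounded hs l).mem _ φ.2⟩) Filter.atTop
      (nhds ((g : gelfandShilov n s →ₗ[ℂ] ℂ) φ)) := by
  obtain ⟨h, hh, A, hA⟩ := φ.2
  obtain ⟨h', hh', K, hK, hrem⟩ := d.exists_remainder_bound hs hh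
  obtain ⟨C, hC⟩ := g.2 h' hh'
  rw [Metric.tendsto_atTop]
  intro ε hε
  obtain ⟨N, hN⟩ := exists_nat_gt (|C * (K * A)| / ε)
  have hN0 : (0 : ℝ) < N := (by positivity : 0 ≤ |C * (K * A)| / ε).trans_lt hN
  refine ⟨cube n (N + 4), fun S hS => ?_⟩
  have h1 := hrem A φ hA N hN0 S fun x hx => (window_subset_cube hx).trans hS
  let ψ : gelfandShilov n s :=
    φ - ∑ l ∈ S, ⟨d.mulσ l φ, (d.mulσ_isGSBounded hs l).mem _ φ.2⟩
  have hψ : (ψ : 𝓢(Rn n, ℂ)) = φ - ∑ l ∈ S, d.mulσ l φ := by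
    simp [ψ]
  have h2 := hC (K * A / N) ψ (by rw [hψ]; exact h1)
  rw [dist_comm, dist_eq_norm, ← map_sum, ← map_sub]
  refine h2.trans_lt ?_
  rw [← mul_div_assoc, div_lt_iff₀ hN0]
  rw [div_lt_iff₀ hε] at hN
  linarith [le_abs_self (C * (K * A))]

end FrequencyDecomposition

end GevreyModulation
-- □_k on functions: Bernstein's inequality and frequency localization of products.
namespace GevreyModulation

variable {n : ℕ} {s : ℝ}

theorem integrable_mul_schwartz {p : ℝ≥0∞} (hp : 1 ≤ p) {u : Rn n → ℂ} (hu : MemLp u p volume)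
    (φ : 𝓢(Rn n, ℂ)) : Integrable fun x => u x * φ x := by
  have : p.HolderConjugate (ENNReal.conjExponent p) := ENNReal.HolderConjugate.conjExponent hp
  exact MemLp.integrable_mul (p := p) (q := ENNReal.conjExponent p) hu (φ.memLp _ _)

theorem lpNorm_le_of_represents {p : ℝ≥0∞} {u : Rn n → ℂ} {f : gelfandShilovDual n s}
    (hu : AEStronglyMeasurable u) (h : Represents u f) : lpNorm p f ≤ eLpNorm u p volume := by
  rcases eq_or_ne (eLpNorm u p volume) ⊤ with ht | ht
  · rw [ht]
    exact le_top
  · exact iInf₂_le u ⟨⟨hu, ht.lt_top⟩, h⟩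

theorem lpNorm_eq_of_represents (d : FrequencyDecomposition n s) (hs : 0 ≤ s) {p : ℝ≥0∞} (hp : 1 ≤ p)
    {u : Rn n → ℂ} {f : gelfandShilovDual n s} (hu : MemLp u p volume) (h : Represents u f) :
    lpNorm p f = eLpNorm u p volume := by
  refine le_antisymm (lpNorm_le_of_represents hu.1 h) (le_iInf₂ fun v hv => ?_)
  rw [eLpNorm_congr_ae (h.ae_eq d hs hp hp hu hv.1 hv.2)]

theorem exists_represents_of_lpNorm_lt_top {p : ℝ≥0∞} {f : gelfandShilovDual n s}
    (h : lpNorm p f < ⊤) : ∃ u, MemLp u p volume ∧ Represents u f := by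
  obtain ⟨u, hu⟩ := iInf_lt_iff.mp h
  obtain ⟨hu, -⟩ := iInf_lt_iff.mp hu
  exact ⟨u, hu⟩

theorem conv_congr_ae {K u v : Rn n → ℂ} (h : u =ᵐ[volume] v) : conv K u = conv K v := by
  funext x
  refine integral_congr_ae ?_
  filter_upwards [h] with y hy
  rw [hy]

/-- A bounded function defines a Gelfand-Shilov distribution. -/
theorem exists_represents_of_bounded (hs : 0 ≤ s) {u : Rn n → ℂ} (hu : MemLp u ⊤ volume) :
    ∃ f : gelfandShilovDual n s, Represents u f := by
  have int (φ : 𝓢(Rn n, ℂ)) := integrable_mul_schwartz le_top hu φ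
  let L : gelfandShilov n s →ₗ[ℂ] ℂ :=
    { toFun := fun φ => ∫ x, u x * (φ : 𝓢(Rn n, ℂ)) x
      map_add' := fun φ ψ => by
        rw [← integral_add (int φ) (int ψ)]
        refine integral_congr_ae (.of_forall fun x => ?_)
        simp only [Submodule.coe_add, _root_.add_apply]
        ring
      map_smul' := fun c φ => by
        rw [RingHom.id_apply, smul_eq_mul, ← integral_const_mul]
        refine integral_congr_ae (.of_forall fun x => ?_)
        simp only [Submodule.coe_smul, _root_.smul_apply, smul_eq_mul]
        ring }
  refine ⟨⟨L, fun h hh => ?_⟩, fun φ => rfl⟩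
  obtain ⟨h', hh', K, hK, H⟩ :=
    exists_integral_bound (V := Rn n) s (max h 1) hs (le_max_right _ _)
  refine ⟨(eLpNorm u ⊤ volume).toReal * K, fun A φ hφ => ?_⟩
  -- With both exponents 0 the integral bound controls the L¹ norm of φ by its Gelfand-Shilov
  -- constant.
  have h1 := H A φ (hφ.mono hh.le (le_max_left _ _) le_rfl) 0 0
  simp only [pow_zero, norm_iteratedFDeriv_zero, one_mul, add_zero, mul_one, Nat.factorial_zero,
    Nat.cast_one, Real.one_rpow] at h1
  change ‖∫ x, u x * (φ : 𝓢(Rn n, ℂ)) x‖ ≤ _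
  calc _ ≤ ∫ x, (eLpNorm u ⊤ volume).toReal * ‖(φ : 𝓢(Rn n, ℂ)) x‖ := by
        refine norm_integral_le_of_norm_le ((φ : 𝓢(Rn n, ℂ)).integrable.norm.const_mul _) ?_
        filter_upwards [enorm_ae_le_eLpNormEssSup u volume] with x hx
        rw [norm_mul]
        gcongr
        rw [← toReal_enorm]
        exact ENNReal.toReal_mono hu.2.ne hx
    _ ≤ _ := by
        rw [integral_const_mul, mul_assoc]
        gcongr

namespace FrequencyDecomposition

variable (d : FrequencyDecomposition n s)

/-- Transposition reverses the order of composition, which is why `boxTest` begins with the inverse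
Fourier transform. -/
theorem box_apply (hs : 1 < s) (k : Fin n → ℤ) (f : gelfandShilovDual n s) (φ : gelfandShilov n s) :
    (box hs d k f : gelfandShilov n s →ₗ[ℂ] ℂ) φ =
      (f : gelfandShilov n s →ₗ[ℂ] ℂ) ⟨d.boxTest k φ, d.boxTest_mem hs.le k φ.2⟩ := rfl

theorem integral_conv_kernel_mul (hs : 1 ≤ s) {p : ℝ≥0∞} (hp : 1 ≤ p) {u : Rn n → ℂ}
    (hu : MemLp u p volume) (k : Fin n → ℤ) (φ : 𝓢(Rn n, ℂ)) :
    ∫ x, conv (d.kernel k) u x * φ x = ∫ y, u y * d.boxTest k φ y := by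
  have : (ENNReal.conjExponent p).HolderConjugate p :=
    (ENNReal.HolderConjugate.conjExponent hp).symm
  simp_rw [d.boxTest_apply hs, mul_comm (conv _ _ _), mul_comm (u _)]
  exact integral_mul_conv (φ.memLp (ENNReal.conjExponent p) _) (d.kernel k).continuous
    (d.kernel k).integrable hu

theorem represents_box (hs : 1 < s) {p : ℝ≥0∞} (hp : 1 ≤ p) {u : Rn n → ℂ}
    (hu : MemLp u p volume) {f : gelfandShilovDual n s} (hf : Represents u f) (k : Fin n → ℤ) :
    Represents (conv (d.kernel k) u) (box hs d k f) := fun φ => by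
  rw [d.integral_conv_kernel_mul hs.le hp hu, d.box_apply hs]
  exact hf _

/-- Convolution with a kernel that reproduces functions with frequencies in the support of `σ_l`. -/
noncomputable def reproduce (l : Fin n → ℤ) (u : Rn n → ℂ) (x : Rn n) : ℂ :=
  ∑ r ∈ cube n 2, conv (d.kernel (l + r)) u x

/-- The constant in the Bernstein inequality `‖□_l f‖_∞ ≤ C ‖□_l f‖_p`. -/
noncomputable def bernsteinConst (p : ℝ≥0∞) : ℝ≥0∞ :=
  (cube n 2).card * eLpNorm (d.kernel 0) (ENNReal.conjExponent p) volume

theorem bernsteinConst_lt_top (p : ℝ≥0∞) : d.bernsteinConst p < ⊤ :=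
  ENNReal.mul_lt_top (ENNReal.natCast_lt_top _) ((d.kernel 0).memLp _ _).2

theorem memLp_reproduce {p : ℝ≥0∞} (hp : 1 ≤ p) (l : Fin n → ℤ) {u : Rn n → ℂ}
    (hu : MemLp u p volume) : MemLp (d.reproduce l u) p volume :=
  memLp_finsetSum _ fun _ _ => memLp_conv hp (d.kernel _).continuous (d.kernel _).integrable hu

/-- Bernstein's inequality for u fixed by `reproduce`. It holds at every point, not just almost
everywhere, since convolutions are defined pointwise. -/
theorem enorm_reproduce_le {p : ℝ≥0∞} (hp : 1 ≤ p) (l : Fin n → ℤ) {u : Rn n → ℂ}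
    (hu : AEStronglyMeasurable u) (x : Rn n) :
    ‖d.reproduce l u x‖ₑ ≤ d.bernsteinConst p * eLpNorm u p volume := by
  have : (ENNReal.conjExponent p).HolderConjugate p :=
    (ENNReal.HolderConjugate.conjExponent hp).symm
  refine (enorm_sum_le _ _).trans ?_
  calc _ ≤ ∑ r ∈ cube n 2, eLpNorm (d.kernel 0) (ENNReal.conjExponent p) volume *
        eLpNorm u p volume := Finset.sum_le_sum fun r _ => by
          rw [← d.eLpNorm_kernel (l + r)]
          exact enorm_conv_le (d.kernel _).continuous hu x
    _ = _ := by rw [Finset.sum_const, nsmul_eq_mul, bernsteinConst, mul_assoc]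

theorem reproduce_ae_eq (hs : 1 < s) {p : ℝ≥0∞} (hp : 1 ≤ p) {l : Fin n → ℤ} {u : Rn n → ℂ}
    (hu : MemLp u p volume) {f : gelfandShilovDual n s} (hf : Represents u (box hs d l f)) :
    d.reproduce l u =ᵐ[volume] u := by
  refine Represents.ae_eq d (by linarith) hp hp (d.memLp_reproduce hp l hu) hu (fun φ => ?_) hf
  let ψ : gelfandShilov n s :=
    ⟨∑ r ∈ cube n 2, d.boxTest (l + r) φ, Submodule.sum_mem _ fun r _ => d.boxTest_mem hs.le _ φ.2⟩
  -- Replacing φ by the sum of its neighbouring blocks does not change σ_l 𝓕⁻¹φ, hence not the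
  -- pairing with □_l f. Moving these blocks back onto u produces `reproduce`.
  have h1 : (box hs d l f : gelfandShilov n s →ₗ[ℂ] ℂ) φ =
      (box hs d l f : gelfandShilov n s →ₗ[ℂ] ℂ) ψ := by
    rw [d.box_apply hs, d.box_apply hs]
    congr 2
    exact (d.boxTest_sum_cube hs.le l φ).symm
  rw [h1, hf ψ]
  simp only [ψ, reproduce, Finset.sum_mul]
  simp_rw [_root_.sum_apply, Finset.mul_sum]
  rw [integral_finsetSum _ fun r _ => integrable_mul_schwartz hp hu _,
    integral_finsetSum _ fun r _ => integrable_mul_schwartz hp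
      (memLp_conv hp (d.kernel _).continuous (d.kernel _).integrable hu) _]
  exact Finset.sum_congr rfl fun r _ => (d.integral_conv_kernel_mul hs.le hp hu _ _).symm

/-- A good representative of `□_l f`. -/
theorem exists_represents_box (hs : 1 < s) {p : ℝ≥0∞} (hp : 1 ≤ p) {l : Fin n → ℤ}
    {f : gelfandShilovDual n s} (h : lpNorm p (box hs d l f) < ⊤) :
    ∃ u, MemLp u p volume ∧ Represents u (box hs d l f) ∧
      eLpNorm u p volume = lpNorm p (box hs d l f) ∧ d.reproduce l u = u := by
  obtain ⟨u, hu, hf⟩ := exists_represents_of_lpNorm_lt_top h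
  have hae := d.reproduce_ae_eq hs hp hu hf
  have hf' : Represents (d.reproduce l u) (box hs d l f) := fun φ => by
    rw [hf φ]
    refine integral_congr_ae ?_
    filter_upwards [hae] with x hx
    rw [hx]
  have hu' := d.memLp_reproduce hp l hu
  -- The reproduced function is itself the representative: convolution sees only the a.e. class, so
  -- the fixed-point identity holds everywhere.
  refine ⟨d.reproduce l u, hu', hf', (lpNorm_eq_of_represents d (by linarith) hp hu' hf').symm, ?_⟩
  funext x
  exact Finset.sum_congr rfl fun r _ => by rw [conv_congr_ae hae]

/-- Fubini, applied in z and then in y, isolates the integral of three kernels, which vanishes. -/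
theorem conv_kernel_mul_eq_zero {k l m : Fin n → ℤ} {i : Fin n} (h : 3 < |k i - l i - m i|)
    {u v : Rn n → ℂ} (hu : MemLp u ⊤ volume) (hv : MemLp v ⊤ volume) (x : Rn n) :
    conv (d.kernel k) (fun t => conv (d.kernel l) u t * conv (d.kernel m) v t) x = 0 := by
  have hk : Integrable fun t => d.kernel k (x - t) := (d.kernel k).integrable.comp_sub_left x
  have bdd (g : Rn n → ℂ) (hg : Integrable g) (w : Rn n → ℂ) (hw : MemLp w ⊤ volume) :
      MemLp (fun t => g t * w t) 1 volume :=
    hw.mul' (memLp_one_iff_integrable.mpr hg)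
  have hl := memLp_conv le_top (d.kernel l).continuous (d.kernel l).integrable hu
  have hKm (z : Rn n) : MemLp (fun t => d.kernel m (t - z)) ⊤ volume :=
    ((d.kernel m).memLp ⊤ volume).comp_measurePreserving (measurePreserving_sub_right volume z)
  rw [conv]
  simp_rw [← mul_assoc]
  rw [integral_mul_conv (p := ⊤) (p' := 1) (bdd _ hk _ hl) (d.kernel m).continuous
    (d.kernel m).integrable hv]
  refine integral_eq_zero_of_ae (.of_forall fun z => ?_)
  simp only [Pi.zero_apply]
  refine mul_eq_zero_of_left ?_ _
  have e (t : Rn n) : d.kernel k (x - t) * conv (d.kernel l) u t * d.kernel m (t - z) =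
      (d.kernel k (x - t) * d.kernel m (t - z)) * conv (d.kernel l) u t := by ring
  simp_rw [e]
  rw [integral_mul_conv (p := ⊤) (p' := 1) (bdd _ hk _ (hKm z)) (d.kernel l).continuous
    (d.kernel l).integrable hu]
  refine integral_eq_zero_of_ae (.of_forall fun y => ?_)
  simp only [Pi.zero_apply]
  refine mul_eq_zero_of_left ?_ _
  rw [← d.kernel_mul_mul_eq_zero h x y z]
  refine integral_congr_ae (.of_forall fun t => ?_)
  simp only
  ring

/-- Reproducing u and v moves the indices l and m by at most 2 each, so the threshold 3 for bare
kernels becomes 3 + 2 + 2 = 7. -/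
theorem conv_kernel_mul_eq_zero_of_reproduce {k l m : Fin n → ℤ} (h : k - l - m ∉ cube n 7)
    {u v : Rn n → ℂ} (hu : MemLp u ⊤ volume) (hv : MemLp v ⊤ volume)
    (hlu : d.reproduce l u = u) (hmv : d.reproduce m v = v) (x : Rn n) :
    conv (d.kernel k) (fun t => u t * v t) x = 0 := by
  rw [cube, Fintype.mem_piFinset, not_forall] at h
  obtain ⟨i, hi⟩ := h
  have hc {w : Rn n → ℂ} (hw : MemLp w ⊤ volume) (j : Fin n → ℤ) :=
    memLp_conv le_top (d.kernel j).continuous (d.kernel j).integrable hw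
  have e : (fun t => u t * v t) = fun t => ∑ r ∈ cube n 2, ∑ r' ∈ cube n 2,
      conv (d.kernel (l + r)) u t * conv (d.kernel (m + r')) v t := by
    funext t
    rw [← Finset.sum_mul_sum]
    change _ = d.reproduce l u t * d.reproduce m v t
    rw [hlu, hmv]
  have hint (r r' : Fin n → ℤ) : Integrable fun y => d.kernel k (x - y) *
      (conv (d.kernel (l + r)) u y * conv (d.kernel (m + r')) v y) := by
    have h1 : MemLp (fun y => conv (d.kernel (l + r)) u y * conv (d.kernel (m + r')) v y) ⊤ volume :=
      (hc hv _).mul' (hc hu _)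
    exact integrable_conv_kernel (p' := 1) (d.kernel k).continuous ((d.kernel k).memLp _ _) h1 x
  rw [e, conv]
  simp_rw [Finset.mul_sum]
  rw [integral_finsetSum _ fun r _ => integrable_finsetSum _ fun r' _ => hint r r']
  refine Finset.sum_eq_zero fun r hr => ?_
  rw [integral_finsetSum _ fun r' _ => hint r r']
  refine Finset.sum_eq_zero fun r' hr' => ?_
  refine d.conv_kernel_mul_eq_zero (i := i) ?_ hu hv x
  rw [cube, Fintype.mem_piFinset] at hr hr'
  have h1 := Finset.mem_Icc.mp (hr i)
  have h2 := Finset.mem_Icc.mp (hr' i)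
  rw [Finset.mem_Icc, Pi.sub_apply, Pi.sub_apply] at hi
  rw [Pi.add_apply, Pi.add_apply, lt_abs]
  push_cast at *
  omega

end FrequencyDecomposition

end GevreyModulation
namespace GevreyModulation

/-! ### The weighted convolution estimate on ℤⁿ. -/

section Sequences

variable {n : ℕ}

/-- The weight `e^{|k|^θ}`. -/
noncomputable def weight (n : ℕ) (θ : ℝ) (k : Fin n → ℤ) : ℝ≥0∞ :=
  ENNReal.ofReal (Real.exp (‖latticePoint k‖ ^ θ))

/-- The summable factor `e^{-c|k|^θ}`. -/
noncomputable def decayFactor (n : ℕ) (c θ : ℝ) (k : Fin n → ℤ) : ℝ≥0∞ :=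
  ENNReal.ofReal (Real.exp (-c * ‖latticePoint k‖ ^ θ))

theorem weight_lt_top (θ : ℝ) (k : Fin n → ℤ) : weight n θ k < ⊤ := ENNReal.ofReal_lt_top

theorem decayFactor_one_mul_weight (θ : ℝ) (k : Fin n → ℤ) :
    decayFactor n 1 θ k * weight n θ k = 1 := by
  rw [decayFactor, weight, ← ENNReal.ofReal_mul (Real.exp_pos _).le, ← Real.exp_add]
  simp

theorem tsum_decayFactor_lt_top {c θ : ℝ} (hc : 0 < c) (h0 : 0 < θ) :
    ∑' k, decayFactor n c θ k < ⊤ :=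
  (summable_exp_neg_norm_rpow n hc h0).tsum_ofReal_lt_top

theorem weight_add_le {θ : ℝ} (h0 : 0 < θ) (h1 : θ ≤ 1) (l m r : Fin n → ℤ) :
    weight n θ (l + m + r) ≤ weight n θ r * (weight n θ l * weight n θ m *
      (decayFactor n (2 - 2 ^ θ) θ l + decayFactor n (2 - 2 ^ θ) θ m)) := by
  simp only [weight, decayFactor]
  rw [← ENNReal.ofReal_add (Real.exp_pos _).le (Real.exp_pos _).le,
    ← ENNReal.ofReal_mul (Real.exp_pos _).le, ← ENNReal.ofReal_mul (by positivity),
    ← ENNReal.ofReal_mul (by positivity), latticePoint_add, latticePoint_add]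
  exact ENNReal.ofReal_le_ofReal (exp_rpow_norm_le h0 h1 _ _ _)

/-- The weighted `ℓ^q` norm of a discrete convolution. -/
theorem eLpNorm_weight_mul_conv_le {θ : ℝ} (h0 : 0 < θ) (h1 : θ ≤ 1) {q : ℝ≥0∞} (hq : 1 ≤ q)
    (R : Finset (Fin n → ℤ)) (a b : (Fin n → ℤ) → ℝ≥0∞) :
    eLpNorm (fun k => weight n θ k * ∑ r ∈ R, ∑' l, a l * b (k - r - l)) q Measure.count ≤
      (2 * (∑ r ∈ R, weight n θ r) * ∑' l, decayFactor n (2 - 2 ^ θ) θ l) *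
        eLpNorm (fun k => weight n θ k * a k) q Measure.count *
        eLpNorm (fun k => weight n θ k * b k) q Measure.count := by
  set W := weight n θ
  set w := decayFactor n (2 - 2 ^ θ) θ
  set α : (Fin n → ℤ) → ℝ≥0∞ := fun k => W k * a k with hα
  set β : (Fin n → ℤ) → ℝ≥0∞ := fun k => W k * b k with hβ
  -- A γ is the damped sequence w γ, spread over the shifts in R. It is in ℓ¹ when γ is in ℓ^q,
  -- since every entry of γ is at most its ℓ^q norm and w is summable.
  let A (γ : (Fin n → ℤ) → ℝ≥0∞) (j : Fin n → ℤ) : ℝ≥0∞ := ∑ r ∈ R, W r * (w (j - r) * γ (j - r))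
  have hA (γ : (Fin n → ℤ) → ℝ≥0∞) : ∫⁻ j, A γ j ∂Measure.count ≤
      (∑ r ∈ R, W r) * (∑' l, w l) * eLpNorm γ q Measure.count := by
    rw [lintegral_count]
    calc ∑' j, A γ j = ∑ r ∈ R, W r * ∑' l, w l * γ l := by
          rw [Summable.tsum_finsetSum fun _ _ => ENNReal.summable]
          refine Finset.sum_congr rfl fun r _ => ?_
          rw [ENNReal.tsum_mul_left]
          congr 1
          exact (Equiv.subRight r).tsum_eq fun l => w l * γ l
      _ ≤ ∑ r ∈ R, W r * ((∑' l, w l) * eLpNorm γ q Measure.count) := by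
          refine Finset.sum_le_sum fun r _ => ?_
          gcongr
          rw [← ENNReal.tsum_mul_right]
          refine ENNReal.tsum_le_tsum fun l => ?_
          gcongr
          exact enorm_le_eLpNorm_count γ l (one_pos.trans_le hq).ne'
      _ = _ := by rw [← Finset.sum_mul, mul_assoc]
  -- The two terms of the gain in `weight_add_le` place the damping on α or on β, which gives one
  -- convolution each.
  have hpt (k : Fin n → ℤ) : W k * ∑ r ∈ R, ∑' l, a l * b (k - r - l) ≤
      (∑' y, A α (k - y) * β y) + ∑' y, A β (k - y) * α y := by
    have e1 : ∑' y, A α (k - y) * β y =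
        ∑ r ∈ R, ∑' l, W r * (w l * α l * β (k - r - l)) := by
      simp only [A, Finset.sum_mul]
      rw [Summable.tsum_finsetSum fun _ _ => ENNReal.summable]
      refine Finset.sum_congr rfl fun r _ => ?_
      rw [← (Equiv.subLeft (k - r)).tsum_eq]
      refine tsum_congr fun l => ?_
      rw [Equiv.subLeft_apply, show k - (k - r - l) - r = l by abel]
      ring
    have e2 : ∑' y, A β (k - y) * α y =
        ∑ r ∈ R, ∑' l, W r * (α l * (w (k - r - l) * β (k - r - l))) := by
      simp only [A, Finset.sum_mul]
      rw [Summable.tsum_finsetSum fun _ _ => ENNReal.summable]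
      refine Finset.sum_congr rfl fun r _ => tsum_congr fun l => ?_
      rw [sub_right_comm]
      ring
    rw [e1, e2, ← Finset.sum_add_distrib, Finset.mul_sum]
    refine Finset.sum_le_sum fun r _ => ?_
    rw [← ENNReal.tsum_mul_left, ← ENNReal.tsum_add]
    refine ENNReal.tsum_le_tsum fun l => ?_
    have h := weight_add_le h0 h1 l (k - r - l) r
    rw [show l + (k - r - l) + r = k by abel] at h
    calc W k * (a l * b (k - r - l)) ≤ W r * (W l * W (k - r - l) * (w l + w (k - r - l))) *
          (a l * b (k - r - l)) := by gcongr
      _ = _ := by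
          simp only [hα, hβ]
          ring
  have meas (g : (Fin n → ℤ) → ℝ≥0∞) : Measurable g := Measurable.of_discrete
  have young (γ δ : (Fin n → ℤ) → ℝ≥0∞) := eLpNorm_lintegral_sub_mul_le
    (μ := (Measure.count : Measure (Fin n → ℤ))) (meas (A γ)) (meas δ).aemeasurable hq
  simp only [lintegral_count (fun y => A _ (_ - y) * _)] at young
  calc _ ≤ eLpNorm ((fun k => ∑' y, A α (k - y) * β y) + fun k => ∑' y, A β (k - y) * α y) q
        Measure.count := eLpNorm_mono_enorm fun k => by
          rw [enorm_eq_self, enorm_eq_self]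
          exact hpt k
    _ ≤ _ := eLpNorm_add_le (meas _).aestronglyMeasurable (meas _).aestronglyMeasurable hq
    _ ≤ _ := add_le_add (young α β) (young β α)
    _ ≤ (∑ r ∈ R, W r) * (∑' l, w l) * eLpNorm α q Measure.count * eLpNorm β q Measure.count +
        (∑ r ∈ R, W r) * (∑' l, w l) * eLpNorm β q Measure.count * eLpNorm α q Measure.count := by
        gcongr
        · exact hA α
        · exact hA β
    _ = _ := by ring

theorem sum_filter_sub_mem_le (S R : Finset (Fin n → ℤ)) (j : Fin n → ℤ) (g : (Fin n → ℤ) → ℝ≥0∞) :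
    ∑ m ∈ S with j - m ∈ R, g m ≤ ∑ r ∈ R, g (j - r) := by
  rw [← Finset.sum_image (f := g) (g := fun r => j - r) fun r _ r' _ h => sub_right_injective h]
  refine Finset.sum_le_sum_of_subset fun m hm => ?_
  exact Finset.mem_image.mpr ⟨j - m, (Finset.mem_filter.mp hm).2, sub_sub_cancel j m⟩

/-- Cubes turn sums over ℤⁿ into limits of sequences, as needed for dominated convergence and for
Fatou. -/
theorem tendsto_cube : Filter.Tendsto (FrequencyDecomposition.cube n) Filter.atTop Filter.atTop := by
  refine Filter.tendsto_atTop_finset_of_monotone (fun a b hab k hk => ?_) fun k => ?_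
  · rw [FrequencyDecomposition.cube, Fintype.mem_piFinset] at *
    intro i
    have := Finset.mem_Icc.mp (hk i)
    rw [Finset.mem_Icc]
    omega
  · refine ⟨∑ i, (k i).natAbs, ?_⟩
    rw [FrequencyDecomposition.cube, Fintype.mem_piFinset]
    intro i
    have := Finset.single_le_sum (f := fun i => (k i).natAbs) (fun _ _ => Nat.zero_le _)
      (Finset.mem_univ i)
    rw [Finset.mem_Icc]
    omega

end Sequences

/-! ### Products of uniformly convergent series of frequency-localized functions. -/

section Series

variable {n : ℕ} {s : ℝ}

theorem tendsto_integral_mul_of_bounded {g w : Rn n → ℂ} {W : ℕ → Rn n → ℂ} {c : ℝ}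
    (hg : Integrable g) (hm : ∀ N, AEStronglyMeasurable (W N)) (hb : ∀ N x, ‖W N x‖ ≤ c)
    (hlim : ∀ x, Filter.Tendsto (fun N => W N x) Filter.atTop (nhds (w x))) :
    Filter.Tendsto (fun N => ∫ x, g x * W N x) Filter.atTop (nhds (∫ x, g x * w x)) := by
  refine tendsto_integral_of_dominated_convergence (fun x => ‖g x‖ * c)
    (fun N => hg.1.mul (hm N)) (hg.norm.mul_const c) (fun N => .of_forall fun x => ?_)
    (.of_forall fun x => (hlim x).const_mul (g x))
  rw [norm_mul]
  gcongr
  exact hb N x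

/-- A family of functions dominated by a summable sequence. -/
structure DominatedFamily (U : (Fin n → ℤ) → Rn n → ℂ) (M : (Fin n → ℤ) → ℝ) : Prop where
  summable : Summable M
  aestronglyMeasurable : ∀ l, AEStronglyMeasurable (U l)
  norm_le : ∀ l x, ‖U l x‖ ≤ M l

namespace DominatedFamily

variable {U V : (Fin n → ℤ) → Rn n → ℂ} {M M' : (Fin n → ℤ) → ℝ}

theorem nonneg (h : DominatedFamily U M) (l : Fin n → ℤ) : 0 ≤ M l :=
  (norm_nonneg _).trans (h.norm_le l 0)

theorem memLp_top (h : DominatedFamily U M) (l : Fin n → ℤ) : MemLp (U l) ⊤ volume :=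
  memLp_top_of_bound (h.aestronglyMeasurable l) _ (.of_forall (h.norm_le l))

theorem norm_sum_le (h : DominatedFamily U M) (S : Finset (Fin n → ℤ)) (x : Rn n) :
    ‖∑ l ∈ S, U l x‖ ≤ ∑' l, M l :=
  (_root_.norm_sum_le _ _).trans ((Finset.sum_le_sum fun l _ => h.norm_le l x).trans
    (h.summable.sum_le_tsum S fun l _ => h.nonneg l))

theorem aestronglyMeasurable_sum (h : DominatedFamily U M) (S : Finset (Fin n → ℤ)) :
    AEStronglyMeasurable fun x => ∑ l ∈ S, U l x :=
  Finset.aestronglyMeasurable_fun_sum _ fun l _ => h.aestronglyMeasurable l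

theorem tendsto (h : DominatedFamily U M) (x : Rn n) :
    Filter.Tendsto (fun N => ∑ l ∈ FrequencyDecomposition.cube n N, U l x) Filter.atTop
      (nhds (∑' l, U l x)) :=
  (Summable.of_norm_bounded h.summable fun l => h.norm_le l x).hasSum.comp tendsto_cube

theorem memLp_tsum (h : DominatedFamily U M) : MemLp (fun x => ∑' l, U l x) ⊤ volume := by
  refine memLp_top_of_bound (aestronglyMeasurable_of_tendsto_ae Filter.atTop
    (fun N => h.aestronglyMeasurable_sum (FrequencyDecomposition.cube n N))
    (.of_forall h.tendsto)) (∑' l, M l) (.of_forall fun x => ?_)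
  exact le_of_tendsto' (h.tendsto x).norm fun N => h.norm_sum_le _ x

/-- For finite partial sums the product expands, only pairs with k - l - m in the cube survive, and
Young's inequality treats each term. The sequences a and b stand for the norms of the pieces. -/
theorem eLpNorm_conv_mul_le (h : DominatedFamily U M) (h' : DominatedFamily V M')
    (d : FrequencyDecomposition n s) {p : ℝ≥0∞} (hp : 1 ≤ p)
    (hU : ∀ l, d.reproduce l (U l) = U l) (hV : ∀ l, d.reproduce l (V l) = V l)
    {a b : (Fin n → ℤ) → ℝ≥0∞} {D : ℝ≥0∞}
    (hUV : ∀ l m, eLpNorm (fun x => U l x * V m x) p volume ≤ D * (a l * b m)) (k : Fin n → ℤ) :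
    eLpNorm (conv (d.kernel k) fun x => (∑' l, U l x) * ∑' m, V m x) p volume ≤
      eLpNorm (d.kernel 0) 1 volume * D *
        ∑ r ∈ FrequencyDecomposition.cube n 7, ∑' l, a l * b (k - r - l) := by
  let u (N : ℕ) (x : Rn n) : ℂ := ∑ l ∈ FrequencyDecomposition.cube n N, U l x
  let v (N : ℕ) (x : Rn n) : ℂ := ∑ l ∈ FrequencyDecomposition.cube n N, V l x
  have hK := (d.kernel k).continuous
  have hum (N : ℕ) : AEStronglyMeasurable (u N) := h.aestronglyMeasurable_sum _
  have hvm (N : ℕ) : AEStronglyMeasurable (v N) := h'.aestronglyMeasurable_sum _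
  have hmul (l m : Fin n → ℤ) : MemLp (fun x => U l x * V m x) ⊤ volume :=
    (h'.memLp_top m).mul' (h.memLp_top l)
  have hlim (x : Rn n) : Filter.Tendsto (fun N => conv (d.kernel k) (fun y => u N y * v N y) x)
      Filter.atTop (nhds (conv (d.kernel k) (fun x => (∑' l, U l x) * ∑' m, V m x) x)) := by
    refine tendsto_integral_mul_of_bounded (c := (∑' l, M l) * ∑' l, M' l)
      ((d.kernel k).integrable.comp_sub_left x) (fun N => (hum N).mul (hvm N)) (fun N y => ?_)
      fun y => (h.tendsto y).mul (h'.tendsto y)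
    rw [norm_mul]
    exact mul_le_mul (h.norm_sum_le _ y) (h'.norm_sum_le _ y) (norm_nonneg _)
      (tsum_nonneg h.nonneg)
  -- By Fatou, pointwise convergence suffices; the double series need not be shown to converge in
  -- L^p.
  refine (Lp.eLpNorm_lim_le_liminf_eLpNorm
    (fun N => aestronglyMeasurable_conv hK ((hum N).mul (hvm N))) _ (.of_forall hlim)).trans ?_
  refine Filter.liminf_le_of_frequently_le' (.of_forall fun N => ?_)
  set S := FrequencyDecomposition.cube n N
  have hexp : conv (d.kernel k) (fun y => u N y * v N y) =
      ∑ l ∈ S, ∑ m ∈ S with k - l - m ∈ FrequencyDecomposition.cube n 7,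
        conv (d.kernel k) (fun y => U l y * V m y) := by
    funext x
    have hint (l m : Fin n → ℤ) : Integrable fun y => d.kernel k (x - y) * (U l y * V m y) :=
      integrable_conv_kernel (p' := 1) hK ((d.kernel k).memLp _ _) (hmul l m) x
    rw [Finset.sum_apply]
    simp_rw [conv, u, v, Finset.sum_mul_sum, Finset.mul_sum]
    rw [integral_finsetSum _ fun l _ => integrable_finsetSum _ fun m _ => hint l m]
    refine Finset.sum_congr rfl fun l _ => ?_
    rw [integral_finsetSum _ fun m _ => hint l m, Finset.sum_apply]
    refine (Finset.sum_subset (Finset.filter_subset _ _) fun m hm hm' => ?_).symm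
    exact d.conv_kernel_mul_eq_zero_of_reproduce
      (fun hmem => hm' (Finset.mem_filter.mpr ⟨hm, hmem⟩)) (h.memLp_top l) (h'.memLp_top m)
      (hU l) (hV m) x
  have hcm (l m : Fin n → ℤ) :
      AEStronglyMeasurable (conv (d.kernel k) fun y => U l y * V m y) :=
    aestronglyMeasurable_conv hK (hmul l m).1
  change eLpNorm (conv (d.kernel k) fun y => u N y * v N y) p volume ≤ _
  rw [hexp]
  calc _ ≤ ∑ l ∈ S, ∑ m ∈ S with k - l - m ∈ FrequencyDecomposition.cube n 7,
        eLpNorm (conv (d.kernel k) (fun y => U l y * V m y)) p volume := by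
        refine (eLpNorm_sum_le (fun l _ =>
          Finset.aestronglyMeasurable_sum _ fun m _ => hcm l m) hp).trans ?_
        exact Finset.sum_le_sum fun l _ => eLpNorm_sum_le (fun m _ => hcm l m) hp
    _ ≤ ∑ l ∈ S, ∑ m ∈ S with k - l - m ∈ FrequencyDecomposition.cube n 7,
        eLpNorm (d.kernel 0) 1 volume * D * (a l * b m) := by
        refine Finset.sum_le_sum fun l _ => Finset.sum_le_sum fun m _ => ?_
        refine (eLpNorm_conv_le hp hK (hmul l m).1).trans ?_
        rw [d.eLpNorm_kernel, mul_assoc]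
        gcongr
        exact hUV l m
    -- The substitution r = k - l - m; dropping the condition m ∈ S only adds nonnegative terms.
    _ ≤ ∑ l ∈ S, ∑ r ∈ FrequencyDecomposition.cube n 7,
        eLpNorm (d.kernel 0) 1 volume * D * (a l * b (k - l - r)) :=
        Finset.sum_le_sum fun l _ => sum_filter_sub_mem_le S _ (k - l) fun m =>
          eLpNorm (d.kernel 0) 1 volume * D * (a l * b m)
    _ = eLpNorm (d.kernel 0) 1 volume * D *
        ∑ r ∈ FrequencyDecomposition.cube n 7, ∑ l ∈ S, a l * b (k - r - l) := by
        rw [Finset.sum_comm]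
        simp_rw [Finset.mul_sum, sub_right_comm k]
    _ ≤ _ := by
        gcongr with r
        exact ENNReal.sum_le_tsum _

end DominatedFamily

end Series

end GevreyModulation
-- The Gevrey-modulation norm, the product estimate and the linear structure.
namespace GevreyModulation

variable {n : ℕ} {s : ℝ} (hs : 1 < s) (d : FrequencyDecomposition n s)

theorem eLpNorm_mul_le {p q r : ℝ≥0∞} (h : ENNReal.HolderTriple p q r) {u v : Rn n → ℂ}
    (hu : AEStronglyMeasurable u) (hv : AEStronglyMeasurable v) :
    eLpNorm (fun x => u x * v x) r volume ≤ eLpNorm u p volume * eLpNorm v q volume := by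
  have := eLpNorm_le_eLpNorm_mul_eLpNorm_of_nnnorm (hpqr := h) hu hv (fun a b => a * b) 1
    (.of_forall fun x => by rw [nnnorm_mul, one_mul])
  rwa [ENNReal.coe_one, one_mul] at this

theorem eLpNorm_count_le_mul {q c : ℝ≥0∞} {a b : (Fin n → ℤ) → ℝ≥0∞} (h : ∀ k, a k ≤ c * b k) :
    eLpNorm a q Measure.count ≤ c * eLpNorm b q Measure.count :=
  eLpNorm_le_mul_eLpNorm_of_ae_le_mul'' q Measurable.of_discrete.aestronglyMeasurable
    (.of_forall h)

/-- With counting measure, Minkowski and Young apply for all q at once, q = ∞ included. -/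
theorem gmNorm_eq_eLpNorm {p q : ℝ≥0∞} (hq : 1 ≤ q) (f : gelfandShilovDual n s) :
    gmNorm hs d p q f =
      eLpNorm (fun k => weight n (1 / s) k * lpNorm p (box hs d k f)) q Measure.count := by
  rcases eq_or_ne q ⊤ with rfl | ht
  · simp [gmNorm, weight]
  · rw [gmNorm, if_neg ht, eLpNorm_eq_lintegral_rpow_enorm_toReal (one_pos.trans_le hq).ne' ht,
      lintegral_count]
    rfl

theorem lpNorm_box_le {p q : ℝ≥0∞} (hq : 1 ≤ q) (f : gelfandShilovDual n s) (l : Fin n → ℤ) :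
    lpNorm p (box hs d l f) ≤ gmNorm hs d p q f * decayFactor n 1 (1 / s) l := by
  have h := enorm_le_eLpNorm_count (fun k => weight n (1 / s) k * lpNorm p (box hs d k f)) l
    (one_pos.trans_le hq).ne'
  rw [← gmNorm_eq_eLpNorm hs d hq, enorm_eq_self] at h
  calc lpNorm p (box hs d l f) = decayFactor n 1 (1 / s) l * weight n (1 / s) l *
        lpNorm p (box hs d l f) := by rw [decayFactor_one_mul_weight, one_mul]
    _ ≤ decayFactor n 1 (1 / s) l * gmNorm hs d p q f := by
        rw [mul_assoc]
        gcongr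
    _ = _ := mul_comm _ _

theorem lpNorm_box_lt_top {p q : ℝ≥0∞} (hq : 1 ≤ q) {f : gelfandShilovDual n s}
    (hf : f ∈ gevreyModulation hs d p q) (l : Fin n → ℤ) : lpNorm p (box hs d l f) < ⊤ :=
  (lpNorm_box_le hs d hq f l).trans_lt (ENNReal.mul_lt_top hf ENNReal.ofReal_lt_top)

/-- The distributions in `GM^{r,q}_s` are bounded functions, given by the uniformly convergent series
of their frequency-localized pieces. -/
theorem exists_dominatedFamily {r q : ℝ≥0∞} (hr : 1 ≤ r) (hq : 1 ≤ q) {f : gelfandShilovDual n s}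
    (hf : f ∈ gevreyModulation hs d r q) :
    ∃ (U : (Fin n → ℤ) → Rn n → ℂ) (M : (Fin n → ℤ) → ℝ), DominatedFamily U M ∧
      (∀ l, d.reproduce l (U l) = U l) ∧
      (∀ l, eLpNorm (U l) r volume = lpNorm r (box hs d l f)) ∧
      Represents (fun x => ∑' l, U l x) f := by
  choose U hU hrep hnorm hfix using fun l =>
    d.exists_represents_box hs hr (lpNorm_box_lt_top hs d hq hf l)
  have hC : d.bernsteinConst r * gmNorm hs d r q f < ⊤ :=
    ENNReal.mul_lt_top (d.bernsteinConst_lt_top r) hf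
  let M (l : Fin n → ℤ) : ℝ := (d.bernsteinConst r * gmNorm hs d r q f).toReal *
    Real.exp (-1 * ‖latticePoint l‖ ^ (1 / s))
  have hUM : DominatedFamily U M :=
    { summable := (summable_exp_neg_norm_rpow n one_pos (by positivity)).mul_left _
      aestronglyMeasurable := fun l => (hU l).1
      norm_le := fun l x => by
        have h1 := d.enorm_reproduce_le hr l (hU l).1 x
        rw [hfix, hnorm] at h1
        have h2 : ‖U l x‖ₑ ≤ d.bernsteinConst r * gmNorm hs d r q f * decayFactor n 1 (1 / s) l := by
          rw [mul_assoc]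
          refine h1.trans ?_
          gcongr
          exact lpNorm_box_le hs d hq f l
        have h3 := ENNReal.toReal_mono (ENNReal.mul_lt_top hC ENNReal.ofReal_lt_top).ne h2
        rwa [toReal_enorm, ENNReal.toReal_mul, ENNReal.toReal_ofReal (Real.exp_pos _).le] at h3 }
  refine ⟨U, M, hUM, hfix, hnorm, fun φ => ?_⟩
  -- Since ⟨f, φ⟩ = ⟨𝓕f, ψ⟩, the expansion ψ = Σ σ_l ψ gives ⟨f, φ⟩ = Σ ⟨□_l f, φ⟩. By dominated
  -- convergence the same partial sums tend to the integral of the series against φ.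
  let ψ : gelfandShilov n s :=
    ⟨fourierTInv n φ, (scaledFourier_isGSBounded n _ _ hs.le).mem _ φ.2⟩
  have h1 := (d.tendsto_sum_mulσ hs.le (fourierDual hs f) ψ).comp tendsto_cube
  have e1 : (fourierDual hs f : gelfandShilov n s →ₗ[ℂ] ℂ) ψ = (f : gelfandShilov n s →ₗ[ℂ] ℂ) φ := by
    change (f : gelfandShilov n s →ₗ[ℂ] ℂ) ⟨fourierT n (fourierTInv n φ), _⟩ = _
    congr 1
    exact Subtype.ext (fourierT_fourierTInv _)
  have h2 := tendsto_integral_mul_of_bounded (φ : 𝓢(Rn n, ℂ)).integrable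
    (fun N => hUM.aestronglyMeasurable_sum (FrequencyDecomposition.cube n N))
    (fun N x => hUM.norm_sum_le _ x) hUM.tendsto
  rw [e1] at h1
  simp_rw [mul_comm _ ((φ : 𝓢(Rn n, ℂ)) _)]
  refine tendsto_nhds_unique h1 (h2.congr fun N => ?_)
  simp_rw [Finset.mul_sum, mul_comm ((φ : 𝓢(Rn n, ℂ)) _)]
  rw [integral_finsetSum _ fun l _ => integrable_mul_schwartz hr (hU l) _]
  exact Finset.sum_congr rfl fun l _ => (hrep l φ).symm

/-- The product estimate, from an estimate for the products of frequency-localized functions. -/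
theorem exists_product_estimate {p q r : ℝ≥0∞} (hp : 1 ≤ p) (hq : 1 ≤ q) (hr : 1 ≤ r) {D : ℝ≥0∞}
    (hD : D < ⊤)
    (hprod : ∀ (u v : Rn n → ℂ) (l : Fin n → ℤ), AEStronglyMeasurable u → AEStronglyMeasurable v →
      d.reproduce l u = u →
      eLpNorm (fun x => u x * v x) p volume ≤ D * (eLpNorm u r volume * eLpNorm v r volume)) :
    ∃ C : ℝ≥0, 0 < C ∧
      ∀ f ∈ gevreyModulation hs d r q, ∀ g ∈ gevreyModulation hs d r q,
        ∃ h : gelfandShilovDual n s, (∀ h', IsProduct f g h' ↔ h' = h) ∧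
          h ∈ gevreyModulation hs d p q ∧
          gmNorm hs d p q h ≤ C * gmNorm hs d r q f * gmNorm hs d r q g := by
  have hθ0 : 0 < 1 / s := by positivity
  have hθ1 : 1 / s < 1 := (div_lt_one (by linarith)).mpr hs
  -- The strict inequality s > 1 enters here: for θ = 1 the gain would disappear.
  have hc : 0 < 2 - (2 : ℝ) ^ (1 / s) := by
    have := Real.rpow_lt_rpow_of_exponent_lt one_lt_two hθ1
    rw [Real.rpow_one] at this
    linarith
  set R := FrequencyDecomposition.cube n 7
  set E : ℝ≥0∞ := eLpNorm (d.kernel 0) 1 volume * D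
  have hE : E < ⊤ := ENNReal.mul_lt_top ((d.kernel 0).memLp _ _).2 hD
  set Q : ℝ≥0∞ := 2 * (∑ r ∈ R, weight n (1 / s) r) *
    ∑' l, decayFactor n (2 - 2 ^ (1 / s)) (1 / s) l
  have hQ : Q < ⊤ := ENNReal.mul_lt_top (ENNReal.mul_lt_top ENNReal.ofNat_lt_top
    (ENNReal.sum_lt_top.mpr fun r _ => weight_lt_top _ r)) (tsum_decayFactor_lt_top hc hθ0)
  have hEQ : E * Q < ⊤ := ENNReal.mul_lt_top hE hQ
  -- Adding 1 makes the constant positive whatever E * Q is.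
  refine ⟨(E * Q).toNNReal + 1, by positivity, fun f hf g hg => ?_⟩
  obtain ⟨U, M, hU, hUl, hUn, hfU⟩ := exists_dominatedFamily hs d hr hq hf
  obtain ⟨V, M', hV, hVl, hVn, hgV⟩ := exists_dominatedFamily hs d hr hq hg
  have hu := hU.memLp_tsum
  have hv := hV.memLp_tsum
  have huv : MemLp (fun x => (∑' l, U l x) * ∑' l, V l x) ⊤ volume := hv.mul' hu
  obtain ⟨h, hh⟩ := exists_represents_of_bounded (s := s) (by linarith) huv
  have hunique : ∀ h', IsProduct f g h' ↔ h' = h := by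
    intro h'
    constructor
    · rintro ⟨u', v', hu', hv', hfu', hgv', hh'⟩
      have e1 := hfu'.ae_eq d (by linarith) le_top le_top hu' hu hfU
      have e2 := hgv'.ae_eq d (by linarith) le_top le_top hv' hv hgV
      refine Subtype.ext (LinearMap.ext fun φ => ?_)
      rw [hh' φ, hh φ]
      refine integral_congr_ae ?_
      filter_upwards [e1, e2] with x h1 h2
      rw [h1, h2]
    · rintro rfl
      exact ⟨_, _, hu, hv, hfU, hgV, hh⟩
  -- Since the product is bounded, □_k h is its convolution with the kernel, so the series estimate
  -- applies, with the assumed bound for single products.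
  have hk (k : Fin n → ℤ) : lpNorm p (box hs d k h) ≤ E * ∑ r' ∈ R, ∑' l,
      lpNorm r (box hs d l f) * lpNorm r (box hs d (k - r' - l) g) := by
    refine (lpNorm_le_of_represents (aestronglyMeasurable_conv (d.kernel k).continuous huv.1)
      (d.represents_box hs le_top huv hh k)).trans ?_
    refine hU.eLpNorm_conv_mul_le hV d hp hUl hVl
      (a := fun l => lpNorm r (box hs d l f)) (b := fun l => lpNorm r (box hs d l g))
      (fun l m => ?_) k
    rw [← hUn l, ← hVn m]
    exact hprod _ _ l (hU.aestronglyMeasurable l) (hV.aestronglyMeasurable m) (hUl l)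
  have hbound : gmNorm hs d p q h ≤ E * Q * gmNorm hs d r q f * gmNorm hs d r q g := by
    rw [gmNorm_eq_eLpNorm hs d hq, gmNorm_eq_eLpNorm hs d hq, gmNorm_eq_eLpNorm hs d hq, mul_assoc,
      mul_assoc]
    have h1 := eLpNorm_weight_mul_conv_le hθ0 hθ1.le hq R
      (fun l => lpNorm r (box hs d l f)) (fun l => lpNorm r (box hs d l g))
    rw [mul_assoc] at h1
    refine le_trans ?_ (mul_le_mul_right h1 E)
    refine eLpNorm_count_le_mul fun k => ?_
    rw [mul_left_comm]
    gcongr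
    exact hk k
  have hbound' : gmNorm hs d p q h ≤
      ((E * Q).toNNReal + 1 : ℝ≥0) * gmNorm hs d r q f * gmNorm hs d r q g := by
    refine hbound.trans ?_
    gcongr
    rw [ENNReal.coe_add, ENNReal.coe_toNNReal hEQ.ne]
    exact le_self_add
  exact ⟨h, hunique, hbound'.trans_lt (ENNReal.mul_lt_top (ENNReal.mul_lt_top ENNReal.coe_lt_top hf) hg),
    hbound'⟩

theorem box_add (k : Fin n → ℤ) (f g : gelfandShilovDual n s) :
    box hs d k (f + g) = box hs d k f + box hs d k g := by
  simp only [box, map_add]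

theorem box_smul (k : Fin n → ℤ) (c : ℂ) (f : gelfandShilovDual n s) :
    box hs d k (c • f) = c • box hs d k f := by
  simp only [box, map_smul]

theorem Represents.add {p : ℝ≥0∞} (hp : 1 ≤ p) {u v : Rn n → ℂ} {f g : gelfandShilovDual n s}
    (hu : MemLp u p volume) (hv : MemLp v p volume) (hf : Represents u f) (hg : Represents v g) :
    Represents (u + v) (f + g) := fun φ => by
  simp_rw [Pi.add_apply, add_mul]
  rw [integral_add (integrable_mul_schwartz hp hu _) (integrable_mul_schwartz hp hv _), ← hf, ← hg]
  rfl

theorem Represents.smul {u : Rn n → ℂ} {f : gelfandShilovDual n s} (c : ℂ) (hf : Represents u f) :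
    Represents (c • u) (c • f) := fun φ => by
  simp_rw [Pi.smul_apply, smul_eq_mul, mul_assoc]
  rw [integral_const_mul, ← hf]
  rfl

theorem lpNorm_zero (p : ℝ≥0∞) : lpNorm p (0 : gelfandShilovDual n s) = 0 := by
  have h : Represents (0 : Rn n → ℂ) (0 : gelfandShilovDual n s) := fun φ => by simp
  simpa using lpNorm_le_of_represents (p := p) aestronglyMeasurable_zero h

theorem lpNorm_add_le {p : ℝ≥0∞} (hp : 1 ≤ p) (d : FrequencyDecomposition n s) (hs : 0 ≤ s)
    (f g : gelfandShilovDual n s) : lpNorm p (f + g) ≤ lpNorm p f + lpNorm p g := by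
  rcases eq_or_ne (lpNorm p f) ⊤ with hf | hf
  · simp [hf]
  rcases eq_or_ne (lpNorm p g) ⊤ with hg | hg
  · simp [hg]
  obtain ⟨u, hu, hfu⟩ := exists_represents_of_lpNorm_lt_top hf.lt_top
  obtain ⟨v, hv, hgv⟩ := exists_represents_of_lpNorm_lt_top hg.lt_top
  rw [lpNorm_eq_of_represents d hs hp hu hfu, lpNorm_eq_of_represents d hs hp hv hgv]
  exact (lpNorm_le_of_represents (hu.1.add hv.1) (hfu.add hp hu hv hgv)).trans
    (eLpNorm_add_le hu.1 hv.1 hp)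

theorem lpNorm_smul_le {p : ℝ≥0∞} (hp : 1 ≤ p) (d : FrequencyDecomposition n s) (hs : 0 ≤ s) (c : ℂ)
    {f : gelfandShilovDual n s} (hf : lpNorm p f < ⊤) : lpNorm p (c • f) ≤ ‖c‖ₑ * lpNorm p f := by
  obtain ⟨u, hu, hfu⟩ := exists_represents_of_lpNorm_lt_top hf
  rw [lpNorm_eq_of_represents d hs hp hu hfu, ← eLpNorm_const_smul]
  exact lpNorm_le_of_represents (hu.1.const_smul c) (hfu.smul c)

theorem gmNorm_zero {p q : ℝ≥0∞} (hq : 1 ≤ q) : gmNorm hs d p q 0 = 0 := by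
  have h (k : Fin n → ℤ) : box hs d k 0 = 0 := by simp only [box, map_zero]
  simp only [gmNorm_eq_eLpNorm hs d hq, h, lpNorm_zero, mul_zero]
  exact eLpNorm_zero

theorem gmNorm_add_le {p q : ℝ≥0∞} (hp : 1 ≤ p) (hq : 1 ≤ q) (f g : gelfandShilovDual n s) :
    gmNorm hs d p q (f + g) ≤ gmNorm hs d p q f + gmNorm hs d p q g := by
  simp only [gmNorm_eq_eLpNorm hs d hq]
  refine le_trans (eLpNorm_mono_enorm fun k => ?_)
    (eLpNorm_add_le (μ := Measure.count) (f := fun k => weight n (1 / s) k * lpNorm p (box hs d k f))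
      (g := fun k => weight n (1 / s) k * lpNorm p (box hs d k g))
      Measurable.of_discrete.aestronglyMeasurable Measurable.of_discrete.aestronglyMeasurable hq)
  rw [enorm_eq_self, enorm_eq_self, Pi.add_apply, ← mul_add, box_add]
  gcongr
  exact lpNorm_add_le hp d (by linarith) _ _

theorem gmNorm_smul_le {p q : ℝ≥0∞} (hp : 1 ≤ p) (hq : 1 ≤ q) (c : ℂ) {f : gelfandShilovDual n s}
    (hf : f ∈ gevreyModulation hs d p q) : gmNorm hs d p q (c • f) ≤ ‖c‖ₑ * gmNorm hs d p q f := by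
  simp only [gmNorm_eq_eLpNorm hs d hq]
  refine eLpNorm_count_le_mul fun k => ?_
  rw [box_smul, mul_left_comm]
  gcongr
  exact lpNorm_smul_le hp d (by linarith) c (lpNorm_box_lt_top hs d hq hf k)

/-- `GM^{p,q}_s` as a linear subspace of `S_s'`. -/
def gevreyModulationSubmodule {p q : ℝ≥0∞} (hp : 1 ≤ p) (hq : 1 ≤ q) :
    Submodule ℂ (gelfandShilovDual n s) where
  carrier := gevreyModulation hs d p q
  zero_mem' := (gmNorm_zero hs d hq).trans_lt ENNReal.zero_lt_top
  add_mem' := fun {f g} hf hg =>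
    (gmNorm_add_le hs d hp hq f g).trans_lt (ENNReal.add_lt_top.mpr ⟨hf, hg⟩)
  smul_mem' := fun c _ hf =>
    (gmNorm_smul_le hs d hp hq c hf).trans_lt (ENNReal.mul_lt_top enorm_lt_top hf)

end GevreyModulation

theorem theorem3p10 (n : ℕ) (s : ℝ) (hs : 1 < s) (p q : ℝ≥0∞) (hp : 1 ≤ p) (hq : 1 ≤ q)
    (d : FrequencyDecomposition n s) :
    (∃ C : ℝ≥0, 0 < C ∧
      ∀ f ∈ gevreyModulation hs d (2 * p) q, ∀ g ∈ gevreyModulation hs d (2 * p) q,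
        ∃ h : gelfandShilovDual n s, (∀ h', IsProduct f g h' ↔ h' = h) ∧
          h ∈ gevreyModulation hs d p q ∧
          gmNorm hs d p q h ≤ C * gmNorm hs d (2 * p) q f * gmNorm hs d (2 * p) q g) ∧
    (∃ M : Submodule ℂ (gelfandShilovDual n s),
      (M : Set (gelfandShilovDual n s)) = gevreyModulation hs d p q) ∧
    (∃ C : ℝ≥0, 0 < C ∧
      ∀ f ∈ gevreyModulation hs d p q, ∀ g ∈ gevreyModulation hs d p q,
        ∃ h : gelfandShilovDual n s, (∀ h', IsProduct f g h' ↔ h' = h) ∧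
          h ∈ gevreyModulation hs d p q ∧
          gmNorm hs d p q h ≤ C * gmNorm hs d p q f * gmNorm hs d p q g) := by
  have hp2 : 1 ≤ 2 * p := one_le_two.trans (le_mul_of_one_le_right' hp)
  refine ⟨?_, ⟨gevreyModulationSubmodule hs d hp hq, rfl⟩, ?_⟩
  -- Hölder with 1/(2p) + 1/(2p) = 1/p, so D = 1.
  · refine exists_product_estimate hs d hp hq hp2 ENNReal.one_lt_top fun u v l hu hv _ => ?_
    have : ENNReal.HolderTriple (2 * p) (2 * p) p := by
      constructor
      rw [ENNReal.mul_inv (.inl two_ne_zero) (.inl ENNReal.ofNat_ne_top), ← add_mul,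
        ENNReal.inv_two_add_inv_two, one_mul]
    rw [one_mul]
    exact eLpNorm_mul_le this hu hv
  -- Here r = p: the first factor goes into L^∞ by Bernstein, and D is the Bernstein constant.
  · refine exists_product_estimate hs d hp hq hp (d.bernsteinConst_lt_top p) fun u v l hu hv hl => ?_
    rw [← mul_assoc]
    refine (eLpNorm_smul_le_eLpNorm_top_mul_eLpNorm p hv u).trans ?_
    gcongr
    rw [eLpNorm_exponent_top]
    refine essSup_le_of_ae_le _ (.of_forall fun x => ?_)
    have := d.enorm_reproduce_le hp l hu x
    rwa [hl] at this
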